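/- For $0<\alpha\le 2$, $|\theta|\le\min\{\alpha,2-\alpha\}$, $0<\beta\le 1$, consider the space-time fractional diffusion equation $${}_tD_*^{\beta}u(x;t)={}_xD_\theta^{\alpha}u(x;t),\qquad x\in\mathbb R,\ t\ge 0,$$ where the Caputo derivative in time is defined by its Laplace transform, $\int_0^\infty e^{-st}\,{}_tD_*^\beta f(t)\,dt=s^\beta\int_0^\infty e^{-st}f(t)\,dt-s^{\beta-1}f(0^+)$ for $s>0$, and the Riesz–Feller derivative in space by its Fourier transform, $\int e^{i\kappa x}\,{}_xD^\alpha_\theta u\,dx=-|\kappa|^\alpha e^{i\,\mathrm{sign}(\kappa)\theta\pi/2}\,\widehat u(\kappa)$. Let $K^\theta_{\alpha,\beta}(x;t)$ be its fundamental solution, that is, the solution with $u(x;0)=\delta(x)$, $u(\pm\infty;t)=0$, understood as a narrowly continuous family of finite signed measures $K^\theta_{\alpha,\beta}(dx;t)$, $t\ge0$, starting from the Dirac measure at $0$, for which the equation holds after the Fourier transform in $x$. We write $K^\theta_{\alpha,\beta}(x;t)$ for the density of this measure, vanishing at $\pm\infty$ and continuous on $\{x\neq 0\}$, when it has such a density.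 Let $L^\theta_\alpha=K^\theta_{\alpha,1}$ (the Lévy stable density). **Theorem.** Let $0<\alpha\le 2$, $|\theta|\le\min\{\alpha,2-\alpha\}$, $0<\beta\le1$, and let $\alpha=\eta\nu$, $\theta=\gamma\nu$ with $0<\eta\le2$, $|\gamma|\le\min\{\eta,2-\eta\}$, $0<\nu\le1$. Then for all $t>0$ and every Borel set $B\subseteq\mathbb R$ $$K^\theta_{\alpha,\beta}(B;t)=\int_{(0,\infty)}L^\gamma_\eta(B;\xi)\,K^{-\nu}_{\nu,\beta}(d\xi;t),$$ and, whenever the three fundamental solutions have such densities, $$K^\theta_{\alpha,\beta}(x;t)=\int_0^\infty L^\gamma_\eta(x;\xi)\,K^{-\nu}_{\nu,\beta}(\xi;t)\,d\xi\qquad\text{for all }0<x<\infty,\ t>0.$$ Both integrals converge absolutely. -/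

import Mathlib

open MeasureTheory Set Filter Topology
open scoped BoundedContinuousFunction

noncomputable section

namespace FracDiff

/-- The Laplace transform `∫₀^∞ e^{-st} f(t) dt` at a real point `s`. -/
def laplace (f : ℝ → ℂ) (s : ℝ) : ℂ :=
  ∫ t in Ioi (0 : ℝ), Real.exp (-(s * t)) • f t

/-- The Laplace integral of `f` converges absolutely for every `s > 0`. -/
def LaplaceConverges (f : ℝ → ℂ) : Prop :=
  ∀ s : ℝ, 0 < s → IntegrableOn (fun t => Real.exp (-(s * t)) • f t) (Ioi 0)

/-- `g` is the Caputo derivative of order `β`, `0 < β ≤ 1`, of the function `f` of time. The Caputo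
derivative is defined by its Laplace transform
`∫₀^∞ e^{-st} (D_*^β f)(t) dt = s^β ∫₀^∞ e^{-st} f(t) dt - s^{β-1} f(0⁺)`. -/
structure HasCaputoDeriv (β : ℝ) (f g : ℝ → ℂ) : Prop where
  /-- `f 0` is the limit `f(0⁺)`. -/
  continuous_zero : ContinuousWithinAt f (Ici 0) 0
  converges : LaplaceConverges f
  converges_deriv : LaplaceConverges g
  laplace_eq : ∀ s : ℝ, 0 < s → laplace g s = s ^ β • laplace f s - s ^ (β - 1) • f 0

/-- The Fourier transform `û(κ) = ∫ e^{iκx} u(dx)` of a finite signed measure on the line. -/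
def fourierSigned (u : SignedMeasure ℝ) (κ : ℝ) : ℂ :=
  u.integral (fun x : ℝ => Complex.exp (Complex.I * κ * x)) (ContinuousLinearMap.lsmul ℝ ℝ).flip

/-- The Riesz–Feller symbol `|κ|^α e^{i sign(κ) θ π/2}`. -/
def rieszFellerSymbol (α θ κ : ℝ) : ℂ :=
  ((|κ| ^ α : ℝ) : ℂ) * Complex.exp (Complex.I * ((Real.sign κ * θ * Real.pi / 2 : ℝ) : ℂ))

/-- The Fourier transform of the Riesz–Feller derivative of order `α` and asymmetry `θ` of `u`.
The Riesz–Feller derivative is defined by this Fourier transform. -/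
def fourierRieszFeller (α θ : ℝ) (u : SignedMeasure ℝ) (κ : ℝ) : ℂ :=
  -rieszFellerSymbol α θ κ * fourierSigned u κ

/-- `u` is the fundamental solution of the space-time fractional diffusion equation
`D_*^β u = D_θ^α u` (Caputo derivative in `t`, Riesz–Feller derivative in `x`), `0 < β ≤ 1`.

The solution is a family `u t`, `t ≥ 0`, of finite signed measures on the line: this contains the
integrable functions of `x`, and also the moving point masses which solve the equation for
`α = |θ| = 1`, `β = 1`. The initial value is the Dirac measure at the origin and it is attained
continuously, and the equation holds as an equality of generalized functions of `x`, i.e. after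
the Fourier transform in `x`, through which the Riesz–Feller derivative is defined. Finiteness of
the measures `u t` is the vanishing at infinity; for a solution with a density see `HasDensity`. -/
structure IsFundamentalSolution (α θ β : ℝ) (u : ℝ → SignedMeasure ℝ) : Prop where
  initial : u 0 = VectorMeasure.dirac (0 : ℝ) (1 : ℝ)
  continuous : ∀ φ : ℝ →ᵇ ℂ, ContinuousOn
    (fun t => (u t).integral (fun x => φ x) (ContinuousLinearMap.lsmul ℝ ℝ).flip) (Ici 0)
  equation : ∀ κ : ℝ, HasCaputoDeriv β
    (fun t => fourierSigned (u t) κ) (fun t => fourierRieszFeller α θ (u t) κ)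

/-- The solution `u` is given by the function `k`, i.e. `u t` has the density `k x t` for `t > 0`.
As these densities may be infinite or may jump at `x = 0`, the representative `k` is normalized by
continuity on `x ≠ 0`, which determines its value at every `x ≠ 0`. The last condition is the
boundary condition `u(±∞; t) = 0`. -/
structure HasDensity (u : ℝ → SignedMeasure ℝ) (k : ℝ → ℝ → ℝ) : Prop where
  integrable : ∀ t : ℝ, 0 < t → Integrable (fun x => k x t)
  eq_withDensity : ∀ t : ℝ, 0 < t → u t = (volume : Measure ℝ).withDensityᵥ (fun x => k x t)
  continuousOn : ∀ t : ℝ, 0 < t → ContinuousOn (fun x => k x t) {0}ᶜ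
  tendsto_zero : ∀ t : ℝ, 0 < t → Tendsto (fun x => k x t) (cocompact ℝ) (𝓝 0)

end FracDiff

end

/-! Write ψ_{α,θ} for the Riesz–Feller symbol. The Fourier transform in x and the Laplace transform
in t turn the equation into s^{β-1}/(s^β + ψ_{α,θ}(κ)). Since |γ| ≤ 1, ψ_{η,γ} takes values in the
closed right half-plane, and its principal power ψ_{η,γ}^ν is ψ_{α,θ}. For β = 1 the transform of L
at time ξ is exp(-ξ ψ_{η,γ}(κ)). Hence the formula follows, by uniqueness of both transforms, once
the Laplace transform in ξ > 0 of K^{-ν}_{ν,β}, transformed again in t, is known to be s^{β-1}/(s^β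
+ z^ν) for Re z ≥ 0; one then sets z = ψ_{η,γ}(κ).

On the imaginary axis this is the equation itself, because ψ_{ν,-ν}(-y) = (iy)^ν. However,
K^{-ν}_{ν,β} is only a finite signed measure on the whole line; neither positivity nor support in
the half-line is given. The function s^{β-1}/(s^β + z^ν) is bounded and holomorphic for Re z > 0,
and `integral_exp_neg_eq_of_boundary_eq`, an argument of Phragmén–Lindelöf type, shows that the part
on [0,∞) alone carries it. As it tends to 0 when z → +∞, there is no mass at the origin
(`integral_singleton_eq_zero`), so (0,∞) suffices. Self-similarity reduces all times to time 1 and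
supplies the measurability in t needed for Fubini.

For densities, the existence of a density of L forces |γ| < 1. Fourier inversion and one integration
by parts then give |l(x,ξ)| ≤ C/x uniformly in ξ. This makes the integral converge absolutely and
depend continuously on x, and the formula for intervals yields the pointwise one. -/

namespace FracDiff

/-! ### Signed densities and uniqueness of characteristic functions -/

section SignedDensity

lemma measurableEmbedding_sumInl {α β : Type*} [MeasurableSpace α] [MeasurableSpace β] :
    MeasurableEmbedding (Sum.inl : α → α ⊕ β) :=
  ⟨Sum.inl_injective, measurable_inl, fun _ hs => measurableSet_inl_image.2 hs⟩

lemma measurableEmbedding_sumInr {α β : Type*} [MeasurableSpace α] [MeasurableSpace β] :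
    MeasurableEmbedding (Sum.inr : β → α ⊕ β) :=
  ⟨Sum.inr_injective, measurable_inr, fun _ hs => measurableSet_inr_image.2 hs⟩

variable {Ω : Type*} [MeasurableSpace Ω]

lemma integrable_smul_of_bounded {E : Type*} [NormedAddCommGroup E] [NormedSpace ℝ E]
    {M : Measure Ω} {h : Ω → ℝ} (hh : Integrable h M) {G : Ω → E} (hG : StronglyMeasurable G)
    {C : ℝ} (hC : ∀ ω, ‖G ω‖ ≤ C) : Integrable (fun ω => h ω • G ω) M := by
  refine (hh.norm.mul_const C).mono' (hh.aestronglyMeasurable.smul hG.aestronglyMeasurable) ?_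
  filter_upwards with ω
  rw [norm_smul]
  exact mul_le_mul_of_nonneg_left (hC ω) (norm_nonneg _)

lemma isFiniteMeasure_withDensity_ofReal_of_integrable {M : Measure Ω} {h : Ω → ℝ} (hh : Integrable h M) :
    IsFiniteMeasure (M.withDensity fun ω => ENNReal.ofReal (h ω)) :=
  isFiniteMeasure_withDensity_ofReal hh.2

/-- Splitting an integral against a signed density into its positive and negative parts. -/
lemma integral_smul_eq_sub_withDensity {E : Type*} [NormedAddCommGroup E] [NormedSpace ℝ E]
    {M : Measure Ω} {h : Ω → ℝ} (hh : Integrable h M) {G : Ω → E} (hG : StronglyMeasurable G)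
    {C : ℝ} (hC : ∀ ω, ‖G ω‖ ≤ C) :
    ∫ ω, h ω • G ω ∂M = ∫ ω, G ω ∂(M.withDensity fun ω => ENNReal.ofReal (h ω))
      - ∫ ω, G ω ∂(M.withDensity fun ω => ENNReal.ofReal (-h ω)) := by
  have hm := hh.aestronglyMeasurable.aemeasurable
  have hmn : AEMeasurable (fun ω => -h ω) M := hm.neg
  rw [integral_withDensity_eq_integral_toReal_smul₀ hm.ennreal_ofReal
      (ae_of_all _ fun _ => ENNReal.ofReal_lt_top),
    integral_withDensity_eq_integral_toReal_smul₀ hmn.ennreal_ofReal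
      (ae_of_all _ fun _ => ENNReal.ofReal_lt_top), ← integral_sub]
  · congr 1
    ext ω
    rw [← sub_smul]
    congr 1
    simp only [ENNReal.toReal_ofReal']
    rcases le_total (h ω) 0 with h0 | h0
    · simp [h0]
    · simp [h0]
  · refine integrable_smul_of_bounded (h := fun ω => (ENNReal.ofReal (h ω)).toReal) ?_ hG hC
    simpa [ENNReal.toReal_ofReal'] using hh.pos_part
  · refine integrable_smul_of_bounded (h := fun ω => (ENNReal.ofReal (-h ω)).toReal) ?_ hG hC
    simpa [ENNReal.toReal_ofReal'] using hh.neg_part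

/-- A signed density is determined by its characteristic function. -/
lemma integral_comp_smul_eq_zero_of_charFun {M : Measure Ω} {X : Ω → ℝ} (hX : Measurable X)
    {h : Ω → ℝ} (hh : Integrable h M)
    (H : ∀ κ : ℝ, ∫ ω, h ω • Complex.exp (κ * X ω * Complex.I) ∂M = 0)
    {f : ℝ → ℂ} (hf : Measurable f) {C : ℝ} (hC : ∀ x, ‖f x‖ ≤ C) :
    ∫ ω, h ω • f (X ω) ∂M = 0 := by
  have fin1 := isFiniteMeasure_withDensity_ofReal_of_integrable hh
  have fin2 := isFiniteMeasure_withDensity_ofReal_of_integrable hh.neg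
  simp only [Pi.neg_apply] at fin2
  -- The positive and negative parts push forward to finite positive measures with equal
  -- characteristic functions.
  have hmap : (M.withDensity fun ω => ENNReal.ofReal (h ω)).map X
      = (M.withDensity fun ω => ENNReal.ofReal (-h ω)).map X := by
    apply Measure.ext_of_charFun
    ext κ
    have hκ := H κ
    rw [integral_smul_eq_sub_withDensity hh
      (by exact (Measurable.cexp (by fun_prop)).stronglyMeasurable) (C := 1)
      (fun ω => by rw [← Complex.ofReal_mul, Complex.norm_exp_ofReal_mul_I]), sub_eq_zero] at hκ
    rw [charFun_apply_real, charFun_apply_real, integral_map hX.aemeasurable (by fun_prop),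
      integral_map hX.aemeasurable (by fun_prop)]
    exact hκ
  rw [integral_smul_eq_sub_withDensity hh (G := fun ω => f (X ω))
    (hf.comp hX).stronglyMeasurable fun ω => hC (X ω),
    sub_eq_zero]
  have := congrArg (fun μ : Measure ℝ => ∫ x, f x ∂μ) hmap
  simpa only [integral_map hX.aemeasurable hf.aestronglyMeasurable] using this

/-- Complex version of `integral_comp_smul_eq_zero_of_charFun`. -/
lemma integral_comp_mul_eq_zero_of_charFun {M : Measure Ω} {X : Ω → ℝ} (hX : Measurable X)
    {h : Ω → ℂ} (hh : Integrable h M)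
    (H : ∀ κ : ℝ, ∫ ω, h ω * Complex.exp (κ * X ω * Complex.I) ∂M = 0)
    {f : ℝ → ℂ} (hf : Measurable f) {C : ℝ} (hC : ∀ x, ‖f x‖ ≤ C) :
    ∫ ω, h ω * f (X ω) ∂M = 0 := by
  have hint : ∀ {g : ℝ → ℂ} {D : ℝ}, Measurable g → (∀ x, ‖g x‖ ≤ D) →
      (∫ ω, h ω * g (X ω) ∂M = ∫ ω, (h ω).re • g (X ω) ∂M
        + Complex.I * ∫ ω, (h ω).im • g (X ω) ∂M) := by
    intro g D hg hD
    have i1 : Integrable (fun ω => (h ω).re • g (X ω)) M :=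
      integrable_smul_of_bounded hh.re (hg.comp hX).stronglyMeasurable fun ω => hD (X ω)
    have i2 : Integrable (fun ω => (h ω).im • g (X ω)) M :=
      integrable_smul_of_bounded hh.im (hg.comp hX).stronglyMeasurable fun ω => hD (X ω)
    rw [← integral_const_mul, ← integral_add i1 (i2.const_mul _)]
    congr 1
    ext ω
    conv_lhs => rw [← Complex.re_add_im (h ω)]
    simp only [Complex.real_smul]
    ring
  have hexp : ∀ κ : ℝ, Measurable fun x : ℝ => Complex.exp (κ * x * Complex.I) := fun κ => by
    fun_prop
  have hexpn : ∀ κ x : ℝ, ‖Complex.exp (κ * x * Complex.I)‖ ≤ 1 := fun κ x => by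
    rw [← Complex.ofReal_mul, Complex.norm_exp_ofReal_mul_I]
  -- Conjugating the hypothesis at -κ gives the same relation at κ with the sign of the imaginary
  -- part reversed; adding and subtracting separates the two parts.
  have key : ∀ κ : ℝ, ∫ ω, (h ω).re • Complex.exp (κ * X ω * Complex.I) ∂M = 0 ∧
      ∫ ω, (h ω).im • Complex.exp (κ * X ω * Complex.I) ∂M = 0 := by
    intro κ
    have h1 := H κ
    have h2 := H (-κ)
    rw [hint (g := fun x => Complex.exp (κ * x * Complex.I)) (hexp _) (hexpn _)] at h1
    rw [hint (g := fun x => Complex.exp ((-κ : ℝ) * x * Complex.I)) (hexp _) (hexpn _)] at h2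
    have hconj : ∀ g : Ω → ℝ, (starRingEnd ℂ)
        (∫ ω, g ω • Complex.exp ((-κ : ℝ) * X ω * Complex.I) ∂M)
        = ∫ ω, g ω • Complex.exp (κ * X ω * Complex.I) ∂M := by
      intro g
      rw [← integral_conj]
      congr 1
      ext ω
      simp [← Complex.exp_conj]
    have h3 := congrArg (starRingEnd ℂ) h2
    rw [map_add, map_mul, hconj, hconj, Complex.conj_I, map_zero] at h3
    constructor
    · linear_combination (h1 + h3) / 2
    · have : Complex.I * ∫ ω, (h ω).im • Complex.exp (κ * X ω * Complex.I) ∂M = 0 := by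
        linear_combination (h1 - h3) / 2
      simpa using this
  rw [hint hf hC, integral_comp_smul_eq_zero_of_charFun hX (h := fun ω => (h ω).re) hh.re (fun κ => (key κ).1) hf hC,
    integral_comp_smul_eq_zero_of_charFun hX (h := fun ω => (h ω).im) hh.im (fun κ => (key κ).2) hf hC]
  simp

/-- Two signed densities with the same characteristic function have the same integrals. -/
lemma integral_comp_smul_eq_of_charFun {Ω' : Type*} [MeasurableSpace Ω']
    {M : Measure Ω} {M' : Measure Ω'}
    {X : Ω → ℝ} {Y : Ω' → ℝ} (hX : Measurable X) (hY : Measurable Y)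
    {h : Ω → ℝ} {h' : Ω' → ℝ} (hh : Integrable h M) (hh' : Integrable h' M')
    (H : ∀ κ : ℝ, ∫ ω, h ω • Complex.exp (κ * X ω * Complex.I) ∂M
      = ∫ ω, h' ω • Complex.exp (κ * Y ω * Complex.I) ∂M')
    {f : ℝ → ℂ} (hf : Measurable f) {C : ℝ} (hC : ∀ x, ‖f x‖ ≤ C) :
    ∫ ω, h ω • f (X ω) ∂M = ∫ ω, h' ω • f (Y ω) ∂M' := by
  -- On the disjoint union of the two spaces, with weights h and -h', equality of the transforms
  -- becomes the vanishing of one transform.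
  have hsum : Integrable (Sum.elim h fun ω => -h' ω) (M.map Sum.inl + M'.map Sum.inr) := by
    refine Integrable.add_measure ?_ ?_
    · rw [measurableEmbedding_sumInl.integrable_map_iff]
      exact hh
    · rw [measurableEmbedding_sumInr.integrable_map_iff]
      exact hh'.neg
  have hval : ∀ {g : ℝ → ℂ} {D : ℝ}, Measurable g → (∀ x, ‖g x‖ ≤ D) →
      ∫ ω, (Sum.elim h (fun ω => -h' ω)) ω • g (Sum.elim X Y ω) ∂(M.map Sum.inl + M'.map Sum.inr)
        = ∫ ω, h ω • g (X ω) ∂M - ∫ ω, h' ω • g (Y ω) ∂M' := by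
    intro g D hg hD
    have hi := integrable_smul_of_bounded hsum (G := fun ω => g (Sum.elim X Y ω))
      (hg.comp (hX.sumElim hY)).stronglyMeasurable fun ω => hD (Sum.elim X Y ω)
    rw [integral_add_measure (hi.mono_measure (Measure.le_add_right le_rfl))
      (hi.mono_measure (Measure.le_add_left le_rfl)), measurableEmbedding_sumInl.integral_map,
      measurableEmbedding_sumInr.integral_map]
    simp [integral_neg, sub_eq_add_neg]
  have := integral_comp_smul_eq_zero_of_charFun (hX.sumElim hY) hsum (fun κ => by
    rw [hval (g := fun x => Complex.exp (κ * x * Complex.I)) (D := 1) (by fun_prop)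
      (fun x => by rw [← Complex.ofReal_mul, Complex.norm_exp_ofReal_mul_I]), H κ, sub_self]) hf hC
  rw [hval hf hC, sub_eq_zero] at this
  exact this

end SignedDensity

/-! ### Signed measures as weighted positive measures -/

/-- The signed measure `u` has the density `h` with respect to the measure `M`. -/
structure IsWeighted (u : SignedMeasure ℝ) (M : Measure ℝ) (h : ℝ → ℝ) : Prop where
  integrable : Integrable h M
  apply_eq : ∀ B, MeasurableSet B → u B = ∫ x in B, h x ∂M

lemma isFiniteMeasure_variation (u : SignedMeasure ℝ) : IsFiniteMeasure u.variation := by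
  rw [← SignedMeasure.totalVariation_eq_variation, SignedMeasure.totalVariation]
  infer_instance

/-- By the Hahn decomposition, the total variation serves as M, with weight -1 on the negative set
`s` and +1 off it. Vector-measure integrals thereby become ordinary ones, to which Fubini and the
uniqueness results apply. -/
lemma exists_isWeighted (u : SignedMeasure ℝ) :
    ∃ (M : Measure ℝ) (h : ℝ → ℝ), IsFiniteMeasure M ∧ Measurable h ∧ IsWeighted u M h := by
  obtain ⟨s, hs, hpos, hneg⟩ := u.toJordanDecomposition.mutuallySingular
  set p := u.toJordanDecomposition.posPart
  set n := u.toJordanDecomposition.negPart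
  have hn : n.restrict s = n := by
    rw [Measure.restrict_eq_self_of_ae_mem]
    exact hneg
  have hp : p.restrict sᶜ = p := by
    rw [Measure.restrict_eq_self_of_ae_mem]
    simpa [ae_iff] using hpos
  have hm : Measurable (fun x => s.indicator (fun _ => (-2 : ℝ)) x + 1) :=
    (measurable_const.indicator hs).add_const 1
  have hi : Integrable (fun x => s.indicator (fun _ => (-2 : ℝ)) x + 1) (p + n) :=
    ((integrable_const _).indicator hs).add (integrable_const _)
  refine ⟨p + n, fun x => s.indicator (fun _ => (-2 : ℝ)) x + 1, inferInstance, hm, hi, ?_⟩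
  intro B hB
  rw [SignedMeasure.apply_eq_posPart_real_sub_negPart_real u hB, Measure.restrict_add,
    integral_add_measure (hi.mono_measure (Measure.le_add_right le_rfl)).integrableOn
    (hi.mono_measure (Measure.le_add_left le_rfl)).integrableOn]
  have e1 : ∫ x in B, (s.indicator (fun _ => (-2 : ℝ)) x + 1) ∂p = ∫ x in B, (1 : ℝ) ∂p := by
    refine integral_congr_ae (ae_restrict_of_ae ?_)
    have : ∀ᵐ x ∂p, x ∉ s := by simpa [ae_iff] using hpos
    filter_upwards [this] with x hx
    simp [hx]
  have e2 : ∫ x in B, (s.indicator (fun _ => (-2 : ℝ)) x + 1) ∂n = ∫ x in B, (-1 : ℝ) ∂n := by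
    refine integral_congr_ae (ae_restrict_of_ae ?_)
    have : ∀ᵐ x ∂n, x ∈ s := hneg
    filter_upwards [this] with x hx
    simp [hx]
    norm_num
  rw [e1, e2]
  simp [p, n, sub_eq_add_neg]

lemma IsWeighted.restrict {u : SignedMeasure ℝ} {M : Measure ℝ} {h : ℝ → ℝ}
    (hu : IsWeighted u M h) {S : Set ℝ} (hS : MeasurableSet S) :
    IsWeighted (u.restrict S) (M.restrict S) h where
  integrable := hu.integrable.restrict
  apply_eq B hB := by
    rw [VectorMeasure.restrict_apply _ hS hB, hu.apply_eq _ (hB.inter hS),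
      Measure.restrict_restrict hB]

/-- Integrals with respect to a signed measure with a density. -/
lemma IsWeighted.integral_eq {E : Type*} [NormedAddCommGroup E] [NormedSpace ℝ E]
    {u : SignedMeasure ℝ} {M : Measure ℝ} {h : ℝ → ℝ}
    (hu : IsWeighted u M h) {G : ℝ → E} (hG : StronglyMeasurable G)
    {C : ℝ} (hC : ∀ ω, ‖G ω‖ ≤ C) :
    u.integral G (ContinuousLinearMap.lsmul ℝ ℝ).flip = ∫ x, h x • G x ∂M := by
  have fin1 := isFiniteMeasure_withDensity_ofReal_of_integrable hu.integrable
  have fin2 := isFiniteMeasure_withDensity_ofReal_of_integrable hu.integrable.neg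
  have finu := isFiniteMeasure_variation u
  simp only [Pi.neg_apply] at fin2
  have bint : ∀ N : Measure ℝ, IsFiniteMeasure N → Integrable G N := fun N hN =>
    (integrable_const C).mono' hG.aestronglyMeasurable (ae_of_all _ hC)
  -- The decomposition is put in additive form, u + negative part = positive part, so that
  -- additivity of the integral in the measure applies.
  have hsum : u + (M.withDensity fun ω => ENNReal.ofReal (-h ω)).toSignedMeasure
      = (M.withDensity fun ω => ENNReal.ofReal (h ω)).toSignedMeasure := by
    ext B hB
    rw [FunLike.coe_add, Pi.add_apply, hu.apply_eq B hB,
      Measure.toSignedMeasure_apply_measurable hB, Measure.toSignedMeasure_apply_measurable hB]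
    have := integral_smul_eq_sub_withDensity hu.integrable
      (G := B.indicator fun _ => (1 : ℝ)) (stronglyMeasurable_const.indicator hB) (C := 1)
      (fun ω => by by_cases hω : ω ∈ B <;> simp [hω])
    rw [integral_indicator_const _ hB, integral_indicator_const _ hB] at this
    have h2 : ∫ ω, h ω • B.indicator (fun _ => (1 : ℝ)) ω ∂M = ∫ x in B, h x ∂M := by
      rw [← integral_indicator hB]
      congr 1
      ext ω
      by_cases hω : ω ∈ B <;> simp [hω]
    rw [h2] at this
    rw [this]
    simp
  rw [integral_smul_eq_sub_withDensity hu.integrable hG hC]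
  have key := VectorMeasure.integral_add_vectorMeasure (f := G)
    (B := (ContinuousLinearMap.lsmul ℝ ℝ).flip) (μ := u)
    (ν := (M.withDensity fun ω => ENNReal.ofReal (-h ω)).toSignedMeasure) (bint _ finu)
    (bint _ (isFiniteMeasure_variation _))
  rw [hsum, VectorMeasure.integral_toSignedMeasure, VectorMeasure.integral_toSignedMeasure] at key
  rw [key]
  simp

lemma IsWeighted.integral_lsmul_eq {u : SignedMeasure ℝ} {M : Measure ℝ} {h : ℝ → ℝ}
    (hu : IsWeighted u M h) {G : ℝ → ℝ} (hG : Measurable G) {C : ℝ} (hC : ∀ ω, ‖G ω‖ ≤ C) :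
    u.integral G (ContinuousLinearMap.lsmul ℝ ℝ) = ∫ x, h x * G x ∂M := by
  have : ContinuousLinearMap.lsmul ℝ ℝ
      = (ContinuousLinearMap.lsmul ℝ ℝ : ℝ →L[ℝ] ℝ →L[ℝ] ℝ).flip := by
    ext
    simp
  rw [this, hu.integral_eq hG.stronglyMeasurable hC]
  rfl

lemma IsWeighted.fourierSigned_eq {u : SignedMeasure ℝ} {M : Measure ℝ} {h : ℝ → ℝ}
    (hu : IsWeighted u M h) (κ : ℝ) :
    fourierSigned u κ = ∫ x, h x • Complex.exp (κ * x * Complex.I) ∂M := by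
  rw [fourierSigned, hu.integral_eq
    (Continuous.stronglyMeasurable (by fun_prop)) (C := 1)]
  · congr 1
    ext x
    ring_nf
  · intro x
    rw [mul_assoc, mul_comm, ← Complex.ofReal_mul, Complex.norm_exp_ofReal_mul_I]

/-! ### Laplace transforms on the right half-plane -/

section LaplaceTransform

variable {Ω : Type*} [MeasurableSpace Ω] {M : Measure Ω} {X : Ω → ℝ} {h : Ω → ℂ}

lemma norm_exp_neg_mul_le {z : ℂ} (hz : 0 ≤ z.re) {x : ℝ} (hx : 0 ≤ x) :
    ‖Complex.exp (-(z * x))‖ ≤ 1 := by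
  rw [Complex.norm_exp, Real.exp_le_one_iff]
  simpa using mul_nonneg hz hx

lemma aestronglyMeasurable_exp_neg_mul (hX : Measurable X) (hh : Integrable h M) (z : ℂ) :
    AEStronglyMeasurable (fun ω => h ω * Complex.exp (-(z * X ω))) M :=
  hh.aestronglyMeasurable.mul
    (Measurable.stronglyMeasurable (by fun_prop)).aestronglyMeasurable

lemma norm_mul_exp_neg_mul_le (hX0 : ∀ᵐ ω ∂M, 0 ≤ X ω) {z : ℂ} (hz : 0 ≤ z.re) :
    ∀ᵐ ω ∂M, ‖h ω * Complex.exp (-(z * X ω))‖ ≤ ‖h ω‖ := by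
  filter_upwards [hX0] with ω hω
  rw [norm_mul]
  exact mul_le_of_le_one_right (norm_nonneg _) (norm_exp_neg_mul_le hz hω)

lemma integrable_mul_exp_neg_mul (hX : Measurable X) (hX0 : ∀ᵐ ω ∂M, 0 ≤ X ω)
    (hh : Integrable h M) {z : ℂ} (hz : 0 ≤ z.re) :
    Integrable (fun ω => h ω * Complex.exp (-(z * X ω))) M :=
  hh.norm.mono' (aestronglyMeasurable_exp_neg_mul hX hh z) (norm_mul_exp_neg_mul_le hX0 hz)

lemma norm_integral_exp_neg_mul_le (hX0 : ∀ᵐ ω ∂M, 0 ≤ X ω)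
    (hh : Integrable h M) {z : ℂ} (hz : 0 ≤ z.re) :
    ‖∫ ω, h ω * Complex.exp (-(z * X ω)) ∂M‖ ≤ ∫ ω, ‖h ω‖ ∂M :=
  norm_integral_le_of_norm_le hh.norm (norm_mul_exp_neg_mul_le hX0 hz)

lemma continuousOn_integral_exp_neg_mul (hX : Measurable X) (hX0 : ∀ᵐ ω ∂M, 0 ≤ X ω)
    (hh : Integrable h M) :
    ContinuousOn (fun z : ℂ => ∫ ω, h ω * Complex.exp (-(z * X ω)) ∂M) {z | 0 ≤ z.re} := by
  refine continuousOn_of_dominated (bound := fun ω => ‖h ω‖)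
    (fun z _ => aestronglyMeasurable_exp_neg_mul hX hh z)
    (fun z hz => norm_mul_exp_neg_mul_le hX0 hz) hh.norm (ae_of_all _ fun ω => ?_)
  fun_prop

lemma differentiableOn_integral_exp_neg_mul (hX : Measurable X) (hX0 : ∀ᵐ ω ∂M, 0 ≤ X ω)
    (hh : Integrable h M) :
    DifferentiableOn ℂ (fun z : ℂ => ∫ ω, h ω * Complex.exp (-(z * X ω)) ∂M) {z | 0 < z.re} := by
  intro z hz
  have hz : 0 < z.re := hz
  -- On this neighbourhood the derivative is dominated through x e^{-x Re z/2} ≤ 2/Re z.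
  have hopen : {w : ℂ | z.re / 2 < w.re} ∈ 𝓝 z :=
    (isOpen_lt continuous_const Complex.continuous_re).mem_nhds (by simp; linarith)
  refine (hasDerivAt_integral_of_dominated_loc_of_deriv_le (𝕜 := ℂ)
    (F' := fun w ω => h ω * (Complex.exp (-(w * X ω)) * (-X ω)))
    (bound := fun ω => ‖h ω‖ * (2 / z.re)) hopen
    (Eventually.of_forall fun w => aestronglyMeasurable_exp_neg_mul hX hh w)
    (integrable_mul_exp_neg_mul hX hX0 hh hz.le) ?_ ?_ (hh.norm.mul_const _)
    ?_).2.differentiableAt.differentiableWithinAt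
  · exact hh.aestronglyMeasurable.mul
      (Measurable.stronglyMeasurable (by fun_prop)).aestronglyMeasurable
  · filter_upwards [hX0] with ω hω w hw
    have hw : z.re / 2 < w.re := hw
    rw [norm_mul, norm_mul, Complex.norm_exp, norm_neg, Complex.norm_real,
      Real.norm_of_nonneg hω]
    refine mul_le_mul_of_nonneg_left ?_ (norm_nonneg _)
    have h1 : (-(w * X ω)).re ≤ -(z.re / 2 * X ω) := by
      have : (-(w * X ω)).re = -(w.re * X ω) := by simp
      rw [this]
      nlinarith
    have h2 : z.re / 2 * X ω + 1 ≤ Real.exp (z.re / 2 * X ω) := Real.add_one_le_exp _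
    calc Real.exp (-(w * X ω)).re * X ω ≤ Real.exp (-(z.re / 2 * X ω)) * X ω := by
          gcongr
      _ ≤ 2 / z.re := by
          rw [Real.exp_neg, inv_mul_le_iff₀ (Real.exp_pos _), mul_div_assoc', le_div_iff₀ hz]
          nlinarith
  · filter_upwards with ω w _
    have h1 : HasDerivAt (fun w : ℂ => -(w * X ω)) (-(X ω : ℂ)) w := by
      simpa using ((hasDerivAt_id w).mul_const (X ω : ℂ)).fun_neg
    exact h1.cexp.const_mul _

lemma diffContOnCl_integral_exp_neg_mul (hX : Measurable X) (hX0 : ∀ᵐ ω ∂M, 0 ≤ X ω)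
    (hh : Integrable h M) :
    DiffContOnCl ℂ (fun z : ℂ => ∫ ω, h ω * Complex.exp (-(z * X ω)) ∂M) {z | 0 < z.re} := by
  refine ⟨differentiableOn_integral_exp_neg_mul hX hX0 hh, ?_⟩
  rw [Complex.closure_setOfPred_lt_re]
  exact continuousOn_integral_exp_neg_mul hX hX0 hh

lemma isPreconnected_re_pos : IsPreconnected {z : ℂ | 0 < z.re} :=
  (convex_halfSpace_re_gt 0).isPreconnected

/-- As `x → ∞`, the Laplace transform tends to the mass at the origin. -/
lemma tendsto_integral_exp_neg_mul_atTop (hX : Measurable X) (hX0 : ∀ᵐ ω ∂M, 0 ≤ X ω)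
    (hh : Integrable h M) :
    Tendsto (fun x : ℝ => ∫ ω, h ω * Complex.exp (-((x : ℂ) * X ω)) ∂M) atTop
      (𝓝 (∫ ω in {ω | X ω = 0}, h ω ∂M)) := by
  have m0 : MeasurableSet {ω | X ω = 0} := hX (measurableSet_singleton 0)
  rw [← integral_indicator m0]
  refine tendsto_integral_filter_of_dominated_convergence (fun ω => ‖h ω‖)
    (Eventually.of_forall fun x => aestronglyMeasurable_exp_neg_mul hX hh x) ?_ hh.norm ?_
  · filter_upwards [eventually_ge_atTop 0] with x hx
    exact norm_mul_exp_neg_mul_le hX0 (by simpa using hx)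
  · filter_upwards [hX0] with ω hω
    rcases hω.eq_or_lt with h0 | h0
    · rw [indicator_of_mem (by exact h0.symm)]
      simp [← h0]
    · rw [indicator_of_notMem (by exact h0.ne'), tendsto_zero_iff_norm_tendsto_zero]
      have : ∀ x : ℝ, ‖h ω * Complex.exp (-((x : ℂ) * X ω))‖
          = ‖h ω‖ * Real.exp (-(x * X ω)) := by
        intro x
        rw [norm_mul, Complex.norm_exp]
        simp
      simp only [this]
      rw [← mul_zero ‖h ω‖]
      refine Tendsto.const_mul _ (Real.tendsto_exp_neg_atTop_nhds_zero.comp ?_)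
      exact tendsto_id.atTop_mul_const h0

end LaplaceTransform

/-- Uniqueness for the Laplace transform. -/
lemma eqOn_zero_of_laplace_eq_zero {f : ℝ → ℂ} (hf : ContinuousOn f (Ioi 0))
    (hconv : LaplaceConverges f) (h0 : ∀ s : ℝ, 0 < s → laplace f s = 0) :
    EqOn f 0 (Ioi 0) := by
  have hh : Integrable (fun t : ℝ => Real.exp (-(1 * t)) • f t) (volume.restrict (Ioi 0)) :=
    hconv 1 one_pos
  have hX0 : ∀ᵐ t ∂(volume.restrict (Ioi (0 : ℝ))), 0 ≤ t :=
    (ae_restrict_iff' measurableSet_Ioi).2 (ae_of_all _ fun t ht => le_of_lt ht)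
  -- The factor e^{-t} makes the weight integrable; the shifted transform is holomorphic for Re z >
  -- 0 and vanishes on the positive reals, hence everywhere.
  have hzero : EqOn (fun z : ℂ => ∫ t in Ioi (0 : ℝ), Real.exp (-(1 * t)) • f t *
      Complex.exp (-(z * (t : ℝ)))) 0 {z | 0 < z.re} := by
    refine AnalyticOnNhd.eqOn_of_preconnected_of_frequently_eq (z₀ := 1)
      ((differentiableOn_integral_exp_neg_mul measurable_id hX0 hh).analyticOnNhd
        (isOpen_lt continuous_const Complex.continuous_re)) analyticOnNhd_const
      isPreconnected_re_pos (by simp) ?_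
    have hreal : ∀ x : ℝ, 0 < x → ∫ t in Ioi (0 : ℝ), Real.exp (-(1 * t)) • f t *
        Complex.exp (-((x : ℂ) * (t : ℝ))) = 0 := by
      intro x hx
      rw [← h0 (1 + x) (by linarith), laplace]
      congr 1
      ext t
      rw [← Complex.ofReal_mul, ← Complex.ofReal_neg, ← Complex.ofReal_exp, mul_comm,
        ← Complex.real_smul, smul_smul, ← Real.exp_add]
      ring_nf
    have htend : Tendsto (fun x : ℝ => (x : ℂ)) (𝓝[>] 1) (𝓝[≠] 1) := by
      rw [tendsto_nhdsWithin_iff]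
      refine ⟨?_, ?_⟩
      · exact (Complex.continuous_ofReal.tendsto' 1 1 (by simp)).mono_left nhdsWithin_le_nhds
      · filter_upwards [self_mem_nhdsWithin] with x hx
        have : (1 : ℝ) < x := hx
        simp only [mem_compl_iff, mem_singleton_iff]
        exact_mod_cast this.ne'
    refine htend.frequently (Eventually.frequently ?_)
    filter_upwards [self_mem_nhdsWithin] with x hx
    exact hreal x (one_pos.trans hx)
  -- On the line Re z = 1, inside the open half-plane, e^{-t} e^{-(1-iκ)t} = e^{-2t} e^{iκt}, so the
  -- Fourier transform of e^{-2t} f vanishes.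
  have hchar : ∀ κ : ℝ, ∫ t in Ioi (0 : ℝ), (Real.exp (-(2 * t)) • f t) *
      Complex.exp (κ * (t : ℝ) * Complex.I) = 0 := by
    intro κ
    have := hzero (show (1 - κ * Complex.I : ℂ) ∈ {z : ℂ | 0 < z.re} by simp)
    simp only [Pi.zero_apply] at this
    rw [← this]
    congr 1
    ext t
    simp only [Complex.real_smul, Complex.ofReal_exp]
    rw [mul_right_comm, mul_right_comm (Complex.exp _) (f t), ← Complex.exp_add, ← Complex.exp_add]
    congr 2
    push_cast
    ring
  have hh2 : Integrable (fun t : ℝ => Real.exp (-(2 * t)) • f t) (volume.restrict (Ioi 0)) :=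
    hconv 2 two_pos
  have hae : (fun t : ℝ => Real.exp (-(2 * t)) • f t) =ᵐ[volume.restrict (Ioi 0)] 0 := by
    refine hh2.ae_eq_zero_of_forall_setIntegral_eq_zero fun s hs _ => ?_
    have := integral_comp_mul_eq_zero_of_charFun measurable_id hh2 hchar
      (f := s.indicator fun _ => (1 : ℂ)) (measurable_const.indicator hs) (C := 1)
      (fun x => by by_cases hx : x ∈ s <;> simp [hx])
    rw [← this, ← integral_indicator hs]
    congr 1
    ext t
    by_cases hx : t ∈ s <;> simp [hx]
  have hae' : f =ᵐ[volume.restrict (Ioi 0)] 0 := by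
    filter_upwards [hae] with t ht
    simpa using ht
  exact Measure.eqOn_open_of_ae_eq hae' isOpen_Ioi hf continuousOn_const

lemma eqOn_of_laplace_eq {f g : ℝ → ℂ} (hf : ContinuousOn f (Ioi 0))
    (hg : ContinuousOn g (Ioi 0)) (hfc : LaplaceConverges f) (hgc : LaplaceConverges g)
    (h0 : ∀ s : ℝ, 0 < s → laplace f s = laplace g s) : EqOn f g (Ioi 0) := by
  have := eqOn_zero_of_laplace_eq_zero (f := f - g) (hf.sub hg)
    (fun s hs => by
      simp only [Pi.sub_apply, smul_sub]
      exact Integrable.sub (hfc s hs) (hgc s hs))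
    (fun s hs => by
      have := h0 s hs
      rw [laplace, laplace] at this
      simp only [laplace, Pi.sub_apply, smul_sub]
      rw [integral_sub (hfc s hs) (hgc s hs), this, sub_self])
  intro t ht
  simpa [sub_eq_zero] using this ht

/-- A bounded holomorphic function on the right half-plane which is real on the boundary is
constant. -/
lemma exists_eq_const_of_im_eq_zero {f : ℂ → ℂ} (hf : DiffContOnCl ℂ f {z | 0 < z.re}) {C : ℝ}
    (hC : ∀ z : ℂ, 0 ≤ z.re → ‖f z‖ ≤ C) (him : ∀ y : ℝ, (f (y * Complex.I)).im = 0) :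
    ∃ c : ℂ, ∀ z : ℂ, 0 ≤ z.re → f z = c := by
  -- For imaginary w, the bounded function exp(w f) has modulus 1 on the boundary, hence modulus at
  -- most 1 inside by Phragmén–Lindelöf. The choices w = ±i make f real throughout, and the open
  -- mapping theorem makes it constant.
  have key : ∀ w : ℂ, w.re = 0 → ∀ z : ℂ, 0 ≤ z.re → (w * f z).re ≤ 0 := by
    intro w hw z hz
    have hbd : ∀ z : ℂ, 0 ≤ z.re → ‖Complex.exp (w * f z)‖ ≤ Real.exp (‖w‖ * C) := by
      intro z hz
      rw [Complex.norm_exp]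
      refine Real.exp_le_exp.2 ((Complex.re_le_norm _).trans ?_)
      rw [norm_mul]
      exact mul_le_mul_of_nonneg_left (hC z hz) (norm_nonneg _)
    have h1 : ‖Complex.exp (w * f z)‖ ≤ 1 := by
      refine PhragmenLindelof.right_half_plane_of_bounded_on_real
        (f := fun z => Complex.exp (w * f z)) ?_ ⟨0, by norm_num, 0, ?_⟩ ?_ ?_ hz
      · exact Complex.differentiable_exp.comp_diffContOnCl (hf.const_smul w)
      · refine Asymptotics.IsBigO.of_bound (Real.exp (‖w‖ * C)) ?_
        filter_upwards [mem_inf_of_right (mem_principal_self _)] with z hz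
        simpa using hbd z (le_of_lt hz)
      · refine isBoundedUnder_of_eventually_le (a := Real.exp (‖w‖ * C)) ?_
        filter_upwards [eventually_ge_atTop 0] with x hx
        exact hbd x (by simpa using hx)
      · intro x
        rw [Complex.norm_exp, Complex.mul_re, hw, him]
        simp
    rwa [Complex.norm_exp, Real.exp_le_one_iff] at h1
  have him' : ∀ z : ℂ, 0 ≤ z.re → (f z).im = 0 := by
    intro z hz
    have h1 := key Complex.I (by simp) z hz
    have h2 := key (-Complex.I) (by simp) z hz
    simp at h1 h2
    linarith
  have han := hf.differentiableOn.analyticOnNhd (isOpen_lt continuous_const Complex.continuous_re)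
  rcases han.is_constant_or_isOpen isPreconnected_re_pos with ⟨c, hc⟩ | hopen
  · refine ⟨c, fun z hz => ?_⟩
    have : EqOn f (fun _ => c) (closure {z : ℂ | 0 < z.re}) :=
      EqOn.of_subset_closure (fun z hz => hc z hz) hf.continuousOn continuousOn_const
        subset_closure subset_rfl
    apply this
    rw [Complex.closure_setOfPred_lt_re]
    exact hz
  · exfalso
    have ho := hopen _ subset_rfl (isOpen_lt continuous_const Complex.continuous_re)
    have hmem : f 1 + 0 ∈ f '' {z : ℂ | 0 < z.re} := ⟨1, by simp, by simp⟩
    have hcont : Continuous fun r : ℝ => f 1 + r * Complex.I := by fun_prop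
    have hnhds := (ho.preimage hcont).mem_nhds (x := 0) (by simpa using hmem)
    obtain ⟨ε, hε, hball⟩ := Metric.mem_nhds_iff.1 hnhds
    obtain ⟨z, hz, hzeq⟩ := hball (show ε / 2 ∈ Metric.ball (0 : ℝ) ε by
      rw [Metric.mem_ball, Real.dist_eq, sub_zero, abs_of_pos (by linarith)]
      linarith)
    have h1 := him' z (le_of_lt hz)
    rw [hzeq] at h1
    have h2 := him' 1 (by simp)
    simp [h2] at h1
    linarith

/-- If the characteristic function of a signed measure extends to a bounded holomorphic function
on the right half-plane, then this extension is the Laplace transform of the part of the measure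
on the half-line. -/
lemma integral_exp_neg_eq_of_boundary_eq {Ω : Type*} [MeasurableSpace Ω] {M : Measure Ω}
    {X : Ω → ℝ} {h : Ω → ℂ} (hX : Measurable X) (hh : Integrable h M) {H : ℂ → ℂ}
    (hH : DiffContOnCl ℂ H {z | 0 < z.re}) {C : ℝ} (hC : ∀ z : ℂ, 0 ≤ z.re → ‖H z‖ ≤ C)
    (hb : ∀ y : ℝ, H (y * Complex.I) = ∫ ω, h ω * Complex.exp (-(y * Complex.I * X ω)) ∂M) :
    ∀ z : ℂ, 0 ≤ z.re →
      ∫ ω in {ω | 0 ≤ X ω}, h ω * Complex.exp (-(z * X ω)) ∂M = H z := by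
  have mpos : MeasurableSet {ω | 0 ≤ X ω} := hX measurableSet_Ici
  have mneg : MeasurableSet {ω | X ω < 0} := hX measurableSet_Iio
  have hX0 : ∀ᵐ ω ∂(M.restrict {ω | 0 ≤ X ω}), 0 ≤ X ω :=
    (ae_restrict_iff' mpos).2 (ae_of_all _ fun t ht => ht)
  have hX1 : ∀ᵐ ω ∂(M.restrict {ω | X ω < 0}), 0 ≤ (-X) ω :=
    (ae_restrict_iff' mneg).2 (ae_of_all _ fun t ht => by simpa using le_of_lt ht)
  have hhp : Integrable h (M.restrict {ω | 0 ≤ X ω}) := hh.restrict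
  have hhn : Integrable (fun ω => (starRingEnd ℂ) (h ω)) (M.restrict {ω | X ω < 0}) :=
    (Complex.conjLIE.toContinuousLinearEquiv.toContinuousLinearMap.integrable_comp hh).restrict
  -- On the imaginary axis `u` is the transform of the part on X < 0, while `v` is built from the
  -- reflected, conjugated negative part so that its boundary values are conjugate to those of `u`.
  -- Thus u + v and i(u - v) are real on the boundary, and constant.
  set u : ℂ → ℂ := fun z => H z - ∫ ω in {ω | 0 ≤ X ω}, h ω * Complex.exp (-(z * X ω)) ∂M with hu
  set v : ℂ → ℂ := fun z => ∫ ω in {ω | X ω < 0}, (starRingEnd ℂ) (h ω) *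
    Complex.exp (-(z * ((-X) ω : ℝ))) ∂M with hv
  have du : DiffContOnCl ℂ u {z | 0 < z.re} :=
    hH.sub (diffContOnCl_integral_exp_neg_mul hX hX0 hhp)
  have dv : DiffContOnCl ℂ v {z | 0 < z.re} := diffContOnCl_integral_exp_neg_mul hX.neg hX1 hhn
  obtain ⟨Cu, bu⟩ : ∃ Cu, ∀ z : ℂ, 0 ≤ z.re → ‖u z‖ ≤ Cu :=
    ⟨_, fun z hz => (norm_sub_le _ _).trans
      (add_le_add (hC z hz) (norm_integral_exp_neg_mul_le hX0 hhp hz))⟩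
  obtain ⟨Cv, bv⟩ : ∃ Cv, ∀ z : ℂ, 0 ≤ z.re → ‖v z‖ ≤ Cv :=
    ⟨_, fun z hz => norm_integral_exp_neg_mul_le hX1 hhn hz⟩
  have hnorm : ∀ (y : ℝ) (ω : Ω), ‖Complex.exp (-(y * Complex.I * X ω))‖ ≤ 1 := fun y ω => by
    rw [Complex.norm_exp]
    simp
  have ub : ∀ y : ℝ, u (y * Complex.I)
      = ∫ ω in {ω | X ω < 0}, h ω * Complex.exp (-(y * Complex.I * X ω)) ∂M := by
    intro y
    have hi : Integrable (fun ω => h ω * Complex.exp (-(y * Complex.I * X ω))) M := by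
      refine hh.norm.mono' (aestronglyMeasurable_exp_neg_mul hX hh _) (ae_of_all _ fun ω => ?_)
      rw [norm_mul]
      exact mul_le_of_le_one_right (norm_nonneg _) (hnorm y ω)
    simp only [hu]
    rw [hb, ← integral_add_compl mpos hi, add_sub_cancel_left]
    congr 2
    ext ω
    simp
  have uv : ∀ y : ℝ, (starRingEnd ℂ) (u (y * Complex.I)) = v (y * Complex.I) := by
    intro y
    rw [ub, hv, ← integral_conj]
    congr 1
    ext ω
    simp [← Complex.exp_conj]
  obtain ⟨c1, h1⟩ := exists_eq_const_of_im_eq_zero (du.add dv) (C := Cu + Cv)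
    (fun z hz => (norm_add_le _ _).trans (add_le_add (bu z hz) (bv z hz)))
    (fun y => by simp [← uv])
  obtain ⟨c2, h2⟩ := exists_eq_const_of_im_eq_zero ((du.sub dv).const_smul Complex.I)
    (C := Cu + Cv)
    (fun z hz => by
      simp only [Pi.smul_apply, Pi.sub_apply, smul_eq_mul, norm_mul, Complex.norm_I, one_mul]
      exact (norm_sub_le _ _).trans (add_le_add (bu z hz) (bv z hz)))
    (fun y => by simp [← uv])
  have vconst : ∀ z : ℂ, 0 ≤ z.re → v z = (c1 + Complex.I * c2) / 2 := by
    intro z hz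
    have e1 : u z + v z = c1 := h1 z hz
    have e2 : Complex.I * (u z - v z) = c2 := h2 z hz
    linear_combination (e1 + Complex.I * e2) / 2 - (u z - v z) / 2 * Complex.I_sq
  -- The constant value of `v` is its limit at +∞, the mass of the negative part at X = 0, which is
  -- zero.
  have vlim := tendsto_integral_exp_neg_mul_atTop hX.neg hX1 hhn
  have hnull : (M.restrict {ω | X ω < 0}).restrict {ω | (-X) ω = 0} = 0 := by
    have m0 : MeasurableSet {ω | (-X) ω = 0} := hX.neg (measurableSet_singleton 0)
    rw [Measure.restrict_restrict m0]
    convert Measure.restrict_empty using 2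
    ext ω
    simp only [Pi.neg_apply, neg_eq_zero, mem_inter_iff, mem_ofPred_eq, mem_empty_iff_false,
      iff_false, not_and, not_lt]
    exact fun h => h.ge
  rw [hnull, integral_zero_measure] at vlim
  have hc0 : (c1 + Complex.I * c2) / 2 = 0 := by
    refine tendsto_nhds_unique (Tendsto.congr' ?_ tendsto_const_nhds) vlim
    filter_upwards [eventually_ge_atTop (0 : ℝ)] with x hx
    exact (vconst x (by simpa using hx)).symm
  have v0 : ∀ z : ℂ, 0 ≤ z.re → v z = 0 := fun z hz => (vconst z hz).trans hc0
  have e3 : u 0 = 0 := by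
    have := uv 0
    rw [v0 _ (by simp)] at this
    simpa using this
  intro z hz
  have e1 : u z + v z = c1 := h1 z hz
  have e2 : u 0 + v 0 = c1 := h1 0 (by simp)
  rw [v0 z hz] at e1
  rw [v0 0 (by simp), e3] at e2
  have : u z = 0 := by rw [add_zero] at e1 e2; rw [e1, ← e2]
  simp only [hu] at this
  exact (sub_eq_zero.1 this).symm

/-! ### The Riesz–Feller symbol -/

lemma abs_le_one_of_le_min {a b : ℝ} (h : |b| ≤ min a (2 - a)) : |b| ≤ 1 := by
  rcases le_total a 1 with ha | ha
  · exact (h.trans (min_le_left _ _)).trans ha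
  · exact (h.trans (min_le_right _ _)).trans (by linarith)

lemma rieszFellerSymbol_zero {α : ℝ} (hα : α ≠ 0) (θ : ℝ) : rieszFellerSymbol α θ 0 = 0 := by
  simp [rieszFellerSymbol, Real.zero_rpow hα]

lemma abs_sign_mul_le {θ : ℝ} (hθ : |θ| ≤ 1) (κ : ℝ) :
    |Real.sign κ * θ * Real.pi / 2| ≤ Real.pi / 2 := by
  have h1 : |Real.sign κ| ≤ 1 := by
    rcases lt_trichotomy κ 0 with h | h | h
    · simp [Real.sign_of_neg h]
    · simp [h]
    · simp [Real.sign_of_pos h]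
  rw [abs_div, abs_mul, abs_mul, abs_of_pos Real.pi_pos, abs_of_pos (two_pos : (0 : ℝ) < 2)]
  have h2 : |Real.sign κ| * |θ| ≤ 1 := mul_le_one₀ h1 (abs_nonneg _) hθ
  have := mul_le_mul_of_nonneg_right h2 Real.pi_pos.le
  linarith

lemma rieszFellerSymbol_re (α θ κ : ℝ) :
    (rieszFellerSymbol α θ κ).re = |κ| ^ α * Real.cos (Real.sign κ * θ * Real.pi / 2) := by
  rw [rieszFellerSymbol, Complex.re_ofReal_mul, mul_comm Complex.I, Complex.exp_ofReal_mul_I_re]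

lemma rieszFellerSymbol_re_nonneg {α θ : ℝ} (hθ : |θ| ≤ 1) (κ : ℝ) :
    0 ≤ (rieszFellerSymbol α θ κ).re := by
  rw [rieszFellerSymbol_re]
  have := abs_le.1 (abs_sign_mul_le hθ κ)
  exact mul_nonneg (Real.rpow_nonneg (abs_nonneg _) _)
    (Real.cos_nonneg_of_mem_Icc ⟨by linarith, by linarith⟩)

lemma rieszFellerSymbol_mul {α θ c : ℝ} (hc : 0 < c) (κ : ℝ) :
    rieszFellerSymbol α θ (c * κ) = (c ^ α : ℝ) * rieszFellerSymbol α θ κ := by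
  have hs : Real.sign (c * κ) = Real.sign κ := by
    rcases lt_trichotomy κ 0 with h | h | h
    · rw [Real.sign_of_neg h, Real.sign_of_neg (mul_neg_of_pos_of_neg hc h)]
    · simp [h]
    · rw [Real.sign_of_pos h, Real.sign_of_pos (mul_pos hc h)]
  rw [rieszFellerSymbol, rieszFellerSymbol, hs, abs_mul, abs_of_pos hc,
    Real.mul_rpow hc.le (abs_nonneg _)]
  push_cast
  ring

/-- The argument of the symbol is at most π/2 in modulus, so the principal power multiplies it by ν
without crossing the branch cut. -/
lemma rieszFellerSymbol_cpow {η γ ν : ℝ} (hη : 0 < η) (hγ : |γ| ≤ 1) (hν : 0 < ν) (κ : ℝ) :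
    rieszFellerSymbol η γ κ ^ (ν : ℂ) = rieszFellerSymbol (η * ν) (γ * ν) κ := by
  rcases eq_or_ne κ 0 with rfl | hκ
  · rw [rieszFellerSymbol_zero hη.ne', rieszFellerSymbol_zero (mul_pos hη hν).ne',
      Complex.zero_cpow (by exact_mod_cast hν.ne')]
  have hb := abs_le.1 (abs_sign_mul_le hγ κ)
  have hpi := Real.pi_pos
  have hr : 0 < |κ| ^ η := Real.rpow_pos_of_pos (abs_pos.2 hκ) _
  rw [rieszFellerSymbol, rieszFellerSymbol, Real.rpow_mul (abs_nonneg _),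
    Real.rpow_def_of_pos hr ν, Complex.ofReal_exp, ← Complex.exp_add]
  nth_rewrite 1 [← Real.exp_log hr]
  rw [Complex.ofReal_exp, ← Complex.exp_add, Complex.cpow_def_of_ne_zero (Complex.exp_ne_zero _),
    Complex.log_exp]
  · congr 1
    push_cast
    ring
  · simp only [Complex.add_im, Complex.ofReal_im, Complex.I_mul_im, Complex.ofReal_re]
    linarith
  · simp only [Complex.add_im, Complex.ofReal_im, Complex.I_mul_im, Complex.ofReal_re]
    linarith

/-- Its ν-th power identifies the symbol of extremal asymmetry with the boundary values (iy)^ν of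
z^ν. -/
lemma rieszFellerSymbol_one_neg_one (y : ℝ) :
    rieszFellerSymbol 1 (-1) (-y) = y * Complex.I := by
  have h2 : Complex.exp (Complex.I * (Real.pi / 2)) = Complex.I := by
    rw [mul_comm, Complex.exp_pi_div_two_mul_I]
  have h3 : Complex.exp (-(Complex.I * (Real.pi / 2))) = -Complex.I := by
    rw [Complex.exp_neg, h2, Complex.inv_I]
  rcases lt_trichotomy y 0 with h | h | h
  · rw [rieszFellerSymbol, Real.sign_of_pos (by linarith), abs_neg, abs_of_neg h]
    have : Complex.I * ((1 * -1 * Real.pi / 2 : ℝ) : ℂ) = -(Complex.I * (Real.pi / 2)) := by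
      push_cast
      ring
    rw [this, h3]
    simp
  · simp [h, rieszFellerSymbol]
  · rw [rieszFellerSymbol, Real.sign_of_neg (by linarith), abs_neg, abs_of_pos h]
    have : Complex.I * ((-1 * -1 * Real.pi / 2 : ℝ) : ℂ) = Complex.I * (Real.pi / 2) := by
      push_cast
      ring
    rw [this, h2]
    simp

lemma laplaceConverges_of_bounded {f : ℝ → ℂ} (hf : ContinuousOn f (Ioi 0)) {C : ℝ}
    (hC : ∀ t, 0 < t → ‖f t‖ ≤ C) : LaplaceConverges f := by
  intro s hs
  have hi : IntegrableOn (fun t : ℝ => Real.exp (-s * t)) (Ioi 0) :=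
    integrableOn_exp_mul_Ioi (by linarith) 0
  refine (Integrable.mul_const hi C).mono' ?_ ?_
  · have he : Continuous fun t : ℝ => Real.exp (-(s * t)) := by fun_prop
    exact (he.continuousOn.smul hf).aestronglyMeasurable measurableSet_Ioi
  · refine (ae_restrict_iff' measurableSet_Ioi).2 (ae_of_all _ fun t ht => ?_)
    rw [norm_smul, Real.norm_of_nonneg (Real.exp_pos _).le, neg_mul]
    exact mul_le_mul_of_nonneg_left (hC t ht) (Real.exp_pos _).le

/-! ### Transforms and self-similarity of fundamental solutions -/

namespace IsFundamentalSolution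

variable {α θ β : ℝ} {u : ℝ → SignedMeasure ℝ}

lemma continuousOn_fourierSigned (hu : IsFundamentalSolution α θ β u) (κ : ℝ) :
    ContinuousOn (fun t => fourierSigned (u t) κ) (Ici 0) := by
  have := hu.continuous (BoundedContinuousFunction.ofNormedAddCommGroup
    (fun x : ℝ => Complex.exp (Complex.I * κ * x)) (by fun_prop) 1 (fun x => by
      rw [mul_assoc, mul_comm, ← Complex.ofReal_mul, Complex.norm_exp_ofReal_mul_I]))
  exact this

lemma fourierSigned_initial (hu : IsFundamentalSolution α θ β u) (κ : ℝ) :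
    fourierSigned (u 0) κ = 1 := by
  rw [fourierSigned, hu.initial, VectorMeasure.integral_dirac]
  simp

lemma ofReal_rpow_add_ne_zero {s : ℝ} (hs : 0 < s) {z : ℂ} (hz : 0 ≤ z.re) (β : ℝ) :
    ((s ^ β : ℝ) : ℂ) + z ≠ 0 := by
  intro h
  have h1 := congrArg Complex.re h
  simp only [Complex.add_re, Complex.ofReal_re, Complex.zero_re] at h1
  have := Real.rpow_pos_of_pos hs β
  linarith

lemma laplace_fourierSigned (hu : IsFundamentalSolution α θ β u) (hθ : |θ| ≤ 1) (κ : ℝ) {s : ℝ}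
    (hs : 0 < s) : laplace (fun t => fourierSigned (u t) κ) s
      = (s ^ (β - 1) : ℝ) / ((s ^ β : ℝ) + rieszFellerSymbol α θ κ) := by
  have h1 := (hu.equation κ).laplace_eq s hs
  have h2 : laplace (fun t => fourierRieszFeller α θ (u t) κ) s
      = -rieszFellerSymbol α θ κ * laplace (fun t => fourierSigned (u t) κ) s := by
    rw [laplace, laplace, ← integral_const_mul]
    congr 1
    ext t
    simp only [fourierRieszFeller, Complex.real_smul]
    ring
  rw [h2, hu.fourierSigned_initial, Complex.real_smul, Complex.real_smul] at h1
  rw [eq_div_iff (ofReal_rpow_add_ne_zero hs (rieszFellerSymbol_re_nonneg hθ κ) β)]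
  linear_combination -h1

/-- Self-similarity of the fundamental solution. -/
lemma fourierSigned_eq_fourierSigned_one (hu : IsFundamentalSolution α θ β u) (hα : 0 < α)
    (hθ : |θ| ≤ 1) {t : ℝ} (ht : 0 < t) (κ : ℝ) :
    fourierSigned (u t) κ = fourierSigned (u 1) (t ^ (β / α) * κ) := by
  have hc : 0 < t ^ (β / α) := Real.rpow_pos_of_pos ht _
  have hlap : ∀ s : ℝ, (fun τ => Real.exp (-(s * τ)) • fourierSigned (u (t * τ)) κ)
      = fun τ => (fun x => Real.exp (-(s / t * x)) • fourierSigned (u x) κ) (t * τ) := by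
    intro s
    ext τ
    have : s * τ = s / t * (t * τ) := by field_simp
    rw [this]
  -- With t fixed, both sides are functions of an auxiliary time τ with the same Laplace transform;
  -- the claim is the case τ = 1.
  have key : EqOn (fun τ => fourierSigned (u (t * τ)) κ)
      (fun τ => fourierSigned (u τ) (t ^ (β / α) * κ)) (Ioi 0) := by
    refine eqOn_of_laplace_eq ?_ ?_ ?_ (hu.equation _).converges ?_
    · refine ((hu.continuousOn_fourierSigned κ).comp (f := fun τ => t * τ)
        (by fun_prop) fun τ hτ => ?_)
      exact (mul_pos ht hτ).le
    · exact (hu.continuousOn_fourierSigned _).mono Ioi_subset_Ici_self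
    · intro s hs
      rw [hlap]
      refine (integrableOn_Ioi_comp_mul_left_iff
        (fun x => Real.exp (-(s / t * x)) • fourierSigned (u x) κ) 0 ht).2 ?_
      rw [mul_zero]
      exact (hu.equation κ).converges _ (div_pos hs ht)
    · intro s hs
      have h1 : laplace (fun τ => fourierSigned (u (t * τ)) κ) s
          = t⁻¹ • laplace (fun τ => fourierSigned (u τ) κ) (s / t) := by
        rw [laplace, hlap]
        refine (integral_comp_mul_left_Ioi
          (fun x => Real.exp (-(s / t * x)) • fourierSigned (u x) κ) 0 ht).trans ?_
        rw [mul_zero]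
        rfl
      rw [h1, hu.laplace_fourierSigned hθ _ hs, hu.laplace_fourierSigned hθ _ (div_pos hs ht),
        rieszFellerSymbol_mul hc, ← Real.rpow_mul ht.le, div_mul_cancel₀ _ hα.ne',
        Real.div_rpow hs.le ht.le, Real.div_rpow hs.le ht.le, Real.rpow_sub_one ht.ne',
        Complex.real_smul]
      have hd := ofReal_rpow_add_ne_zero hs (z := (t ^ β : ℝ) * rieszFellerSymbol α θ κ)
        (by
          rw [Complex.re_ofReal_mul]
          exact mul_nonneg (Real.rpow_nonneg ht.le _) (rieszFellerSymbol_re_nonneg hθ κ)) β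
      have ht' : (t : ℂ) ≠ 0 := by exact_mod_cast ht.ne'
      have htb : ((t ^ β : ℝ) : ℂ) ≠ 0 := by exact_mod_cast (Real.rpow_pos_of_pos ht β).ne'
      have hd2 : ((s ^ β / t ^ β : ℝ) : ℂ) + rieszFellerSymbol α θ κ
          = ((s ^ β : ℝ) + (t ^ β : ℝ) * rieszFellerSymbol α θ κ) / (t ^ β : ℝ) := by
        push_cast
        field_simp
      rw [hd2]
      push_cast at *
      field_simp
  simpa using key (show (1 : ℝ) ∈ Ioi 0 by simp)

lemma fourierSigned_eq_exp {η γ : ℝ} {L : ℝ → SignedMeasure ℝ}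
    (hL : IsFundamentalSolution η γ 1 L) (hγ : |γ| ≤ 1) {ξ : ℝ} (hξ : 0 < ξ) (κ : ℝ) :
    fourierSigned (L ξ) κ = Complex.exp (-(rieszFellerSymbol η γ κ * ξ)) := by
  have hre := rieszFellerSymbol_re_nonneg (α := η) hγ κ
  have hcont : ContinuousOn (fun t : ℝ => Complex.exp (-(rieszFellerSymbol η γ κ * t))) (Ioi 0) :=
    Continuous.continuousOn (by fun_prop)
  refine eqOn_of_laplace_eq (f := fun t => fourierSigned (L t) κ)
    ((hL.continuousOn_fourierSigned κ).mono Ioi_subset_Ici_self) hcont (hL.equation κ).converges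
    (laplaceConverges_of_bounded hcont fun t ht => norm_exp_neg_mul_le hre ht.le)
    (fun s hs => ?_) hξ
  rw [hL.laplace_fourierSigned hγ κ hs, laplace]
  have hneg : (-((s : ℂ) + rieszFellerSymbol η γ κ)).re < 0 := by
    simp only [Complex.neg_re, Complex.add_re, Complex.ofReal_re]
    linarith
  have := integral_exp_mul_complex_Ioi hneg 0
  simp only [Complex.ofReal_zero, mul_zero, Complex.exp_zero] at this
  rw [sub_self, Real.rpow_zero, Real.rpow_one, ← neg_div_neg_eq, Complex.ofReal_one, ← this]
  congr 1
  ext t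
  rw [Complex.real_smul, Complex.ofReal_exp, ← Complex.exp_add]
  push_cast
  ring_nf

end IsFundamentalSolution

/-! ### The function s^{β-1}/(s^β + z^ν) -/

section Resolvent

variable {s β ν : ℝ}

lemma cpow_re_nonneg (hν0 : 0 < ν) (hν1 : ν ≤ 1) {z : ℂ} (hz : 0 ≤ z.re) :
    0 ≤ (z ^ (ν : ℂ)).re := by
  rw [Complex.cpow_ofReal_re]
  have harg := abs_le.1 (Complex.abs_arg_le_pi_div_two_iff.2 hz)
  have hpi := Real.pi_pos
  refine mul_nonneg (Real.rpow_nonneg (norm_nonneg _) _) (Real.cos_nonneg_of_mem_Icc ⟨?_, ?_⟩)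
  · nlinarith
  · nlinarith

lemma norm_resolvent_le (hs : 0 < s) (hν0 : 0 < ν) (hν1 : ν ≤ 1) {z : ℂ} (hz : 0 ≤ z.re) :
    ‖((s ^ (β - 1) : ℝ) : ℂ) / ((s ^ β : ℝ) + z ^ (ν : ℂ))‖ ≤ s ^ (β - 1) / s ^ β := by
  rw [norm_div, Complex.norm_real, Real.norm_of_nonneg (Real.rpow_nonneg hs.le _)]
  refine div_le_div_of_nonneg_left (Real.rpow_nonneg hs.le _) (Real.rpow_pos_of_pos hs _) ?_
  refine le_trans ?_ (Complex.re_le_norm _)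
  simpa using cpow_re_nonneg hν0 hν1 hz

/-- For ν ≤ 1 the power z^ν keeps a nonnegative real part, so the denominator has no zero; ν > 0
gives continuity at the branch point z = 0. -/
lemma diffContOnCl_resolvent (hs : 0 < s) (hν0 : 0 < ν) (hν1 : ν ≤ 1) :
    DiffContOnCl ℂ (fun z : ℂ => ((s ^ (β - 1) : ℝ) : ℂ) / ((s ^ β : ℝ) + z ^ (ν : ℂ)))
      {z | 0 < z.re} := by
  refine ⟨fun z hz => ?_, ?_⟩
  · have hz : 0 < z.re := hz
    refine DifferentiableAt.differentiableWithinAt ?_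
    refine (differentiableAt_const _).div ((differentiableAt_const _).add
      (differentiableAt_id.cpow (differentiableAt_const _) (Or.inl hz)))
      (IsFundamentalSolution.ofReal_rpow_add_ne_zero hs (cpow_re_nonneg hν0 hν1 hz.le) β)
  · rw [Complex.closure_setOfPred_lt_re]
    intro z hz
    have hz : 0 ≤ z.re := hz
    refine ContinuousWithinAt.div continuousWithinAt_const
      (continuousWithinAt_const.add ?_)
      (IsFundamentalSolution.ofReal_rpow_add_ne_zero hs (cpow_re_nonneg hν0 hν1 hz) β)
    exact (Complex.continuousAt_cpow_const_of_re_pos (Or.inl hz)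
      (by simpa using hν0)).continuousWithinAt

lemma tendsto_resolvent_atTop (hν0 : 0 < ν) :
    Tendsto (fun x : ℝ => ((s ^ (β - 1) : ℝ) : ℂ) / ((s ^ β : ℝ) + (x : ℂ) ^ (ν : ℂ))) atTop
      (𝓝 0) := by
  have h1 : Tendsto (fun x : ℝ => s ^ (β - 1) / (s ^ β + x ^ ν)) atTop (𝓝 0) :=
    tendsto_const_nhds.div_atTop (tendsto_atTop_add_const_left _ _ (tendsto_rpow_atTop hν0))
  have h2 := (Complex.continuous_ofReal.tendsto 0).comp h1
  simp only [Complex.ofReal_zero] at h2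
  refine h2.congr' ?_
  filter_upwards [eventually_ge_atTop 0] with x hx
  simp only [Function.comp]
  push_cast [Complex.ofReal_cpow hx]
  rfl

end Resolvent

/-! ### Joint transforms in time and space -/

section ScaledLaplace

variable {M : Measure ℝ} {h : ℝ → ℝ} {c : ℝ}

lemma norm_smul_exp_scaled_le {z : ℂ} {ξ a r : ℝ} (h0 : 0 ≤ z.re * ξ) (ha : 0 ≤ a) :
    ‖r • Complex.exp (-(z * (a * ξ : ℝ)))‖ ≤ |r| := by
  rw [norm_smul, Real.norm_eq_abs, Complex.norm_exp]
  refine mul_le_of_le_one_right (abs_nonneg _) (Real.exp_le_one_iff.2 ?_)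
  have : (-(z * (a * ξ : ℝ))).re = -(a * (z.re * ξ)) := by
    rw [Complex.neg_re, Complex.re_mul_ofReal]
    ring
  rw [this, neg_nonpos]
  exact mul_nonneg ha h0

lemma continuousOn_scaledLaplace (hh : Integrable h M) {z : ℂ} (hz : ∀ᵐ ξ ∂M, 0 ≤ z.re * ξ) :
    ContinuousOn (fun t : ℝ => ∫ ξ, h ξ • Complex.exp (-(z * (t ^ c * ξ : ℝ))) ∂M) (Ioi 0) := by
  refine continuousOn_of_dominated (bound := fun ξ => |h ξ|) (fun t _ => ?_) (fun t ht => ?_)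
    hh.abs (ae_of_all _ fun ξ => ?_)
  · exact hh.aestronglyMeasurable.smul
      (Continuous.stronglyMeasurable (by fun_prop)).aestronglyMeasurable
  · filter_upwards [hz] with ξ hξ
    exact norm_smul_exp_scaled_le hξ (Real.rpow_nonneg (le_of_lt ht) _)
  · have : ContinuousOn (fun t : ℝ => t ^ c) (Ioi 0) := fun t ht =>
      (Real.continuousAt_rpow_const t c (Or.inl (ne_of_gt ht))).continuousWithinAt
    fun_prop

lemma laplaceConverges_scaledLaplace (hh : Integrable h M) {z : ℂ}
    (hz : ∀ᵐ ξ ∂M, 0 ≤ z.re * ξ) :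
    LaplaceConverges (fun t : ℝ => ∫ ξ, h ξ • Complex.exp (-(z * (t ^ c * ξ : ℝ))) ∂M) := by
  refine laplaceConverges_of_bounded (continuousOn_scaledLaplace hh hz) (C := ∫ ξ, |h ξ| ∂M)
    fun t ht => norm_integral_le_of_norm_le hh.abs ?_
  filter_upwards [hz] with ξ hξ
  exact norm_smul_exp_scaled_le hξ (Real.rpow_nonneg ht.le _)

lemma integrable_exp_smul_prod [SFinite M] (hh : Integrable h M) {s : ℝ} (hs : 0 < s) :
    Integrable (fun p : ℝ × ℝ => ((Real.exp (-(s * p.1)) * h p.2 : ℝ) : ℂ))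
      ((volume.restrict (Ioi 0)).prod M) := by
  have h1 : Integrable (fun t : ℝ => Real.exp (-(s * t))) (volume.restrict (Ioi 0)) := by
    simpa using! integrableOn_exp_mul_Ioi (show -s < 0 by linarith) 0
  exact (h1.mul_prod hh).ofReal

lemma measurable_scaled (c : ℝ) : Measurable fun p : ℝ × ℝ => p.1 ^ c * p.2 := by
  fun_prop

lemma restrict_prod_eq [SFinite M] {S : Set ℝ} {T : Set (ℝ × ℝ)}
    (hT : ∀ p : ℝ × ℝ, 0 < p.1 → (p ∈ T ↔ p.2 ∈ S)) (hTm : MeasurableSet T) :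
    ((volume.restrict (Ioi (0 : ℝ))).prod M).restrict T
      = (volume.restrict (Ioi 0)).prod (M.restrict S) := by
  have h1 : (volume.restrict (Ioi (0 : ℝ))).prod M
      = ((volume : Measure ℝ).prod M).restrict (Ioi 0 ×ˢ univ) := by
    rw [← Measure.prod_restrict, Measure.restrict_univ]
  rw [h1, Measure.restrict_restrict hTm, Measure.prod_restrict]
  congr 1
  ext p
  simp only [mem_inter_iff, mem_prod, mem_univ, and_true, mem_Ioi]
  constructor
  · rintro ⟨hp, h0⟩
    exact ⟨h0, (hT p h0).1 hp⟩
  · rintro ⟨h0, hp⟩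
    exact ⟨(hT p h0).2 hp, h0⟩

/-- The time Laplace transform of a scaled Laplace transform, as an integral over the product. -/
lemma laplace_scaledLaplace [SFinite M] (hh : Integrable h M) {z : ℂ}
    (hz : ∀ᵐ ξ ∂M, 0 ≤ z.re * ξ) {s : ℝ} (hs : 0 < s) :
    laplace (fun t : ℝ => ∫ ξ, h ξ • Complex.exp (-(z * (t ^ c * ξ : ℝ))) ∂M) s
      = ∫ p, ((Real.exp (-(s * p.1)) * h p.2 : ℝ) : ℂ)
        * Complex.exp (-(z * (p.1 ^ c * p.2 : ℝ))) ∂((volume.restrict (Ioi 0)).prod M) := by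
  have hint := integrable_exp_smul_prod hh hs
  rw [integral_prod]
  · rw [laplace]
    congr 1
    ext t
    rw [← integral_smul]
    congr 1
    ext ξ
    simp only [Complex.real_smul]
    push_cast
    ring
  · refine hint.norm.mono' (aestronglyMeasurable_exp_neg_mul (measurable_scaled c) hint z) ?_
    have hfst : ∀ᵐ p ∂((volume.restrict (Ioi (0 : ℝ))).prod M), 0 < p.1 :=
      Measure.quasiMeasurePreserving_fst.ae (p := fun t : ℝ => 0 < t)
        ((ae_restrict_iff' measurableSet_Ioi).2 (ae_of_all _ fun t ht => ht))
    have hsnd : ∀ᵐ p ∂((volume.restrict (Ioi (0 : ℝ))).prod M), 0 ≤ z.re * p.2 :=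
      Measure.quasiMeasurePreserving_snd.ae hz
    filter_upwards [hfst, hsnd] with p h1 h2
    have := norm_smul_exp_scaled_le (r := Real.exp (-(s * p.1)) * h p.2) h2
      (Real.rpow_nonneg h1.le c)
    rw [Complex.norm_real, Real.norm_eq_abs]
    rwa [Complex.real_smul] at this

end ScaledLaplace

/-! ### The solution of extremal asymmetry and its half-line part -/

namespace IsFundamentalSolution

variable {β ν : ℝ} {u : ℝ → SignedMeasure ℝ} {M : Measure ℝ} {h : ℝ → ℝ}

/-- The part on `[0, ∞)` of the fundamental solution with extremal asymmetry carries its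
transform. -/
lemma laplace_halfline_part [SFinite M] (hu : IsFundamentalSolution ν (-ν) β u)
    (hν0 : 0 < ν) (hν1 : ν ≤ 1) (hM : IsWeighted (u 1) M h) {s : ℝ} (hs : 0 < s) :
    ∀ z : ℂ, 0 ≤ z.re →
      ∫ p, ((Real.exp (-(s * p.1)) * h p.2 : ℝ) : ℂ)
        * Complex.exp (-(z * (p.1 ^ (β / ν) * p.2 : ℝ)))
          ∂((volume.restrict (Ioi 0)).prod (M.restrict (Ici 0)))
        = ((s ^ (β - 1) : ℝ) : ℂ) / ((s ^ β : ℝ) + z ^ (ν : ℂ)) := by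
  have hν : |(-ν)| ≤ 1 := by rwa [abs_neg, abs_of_pos hν0]
  have hint := integrable_exp_smul_prod hM.integrable hs
  -- The boundary criterion is applied on the (t,ξ) space with weight e^{-st} h(ξ) and variable
  -- t^{β/ν} ξ. As t > 0, the sign of this variable is that of ξ.
  have main := integral_exp_neg_eq_of_boundary_eq (measurable_scaled (β / ν)) hint
    (diffContOnCl_resolvent (β := β) hs hν0 hν1)
    (fun z hz => norm_resolvent_le hs hν0 hν1 hz) (fun y => by
      have h1 := hu.laplace_fourierSigned hν (-y) hs
      have h2 : rieszFellerSymbol ν (-ν) (-y) = ((y : ℂ) * Complex.I) ^ (ν : ℂ) := by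
        rw [← rieszFellerSymbol_one_neg_one, rieszFellerSymbol_cpow one_pos (by simp) hν0]
        simp
      rw [← h2, ← h1]
      have h3 := laplace_scaledLaplace (c := β / ν) (M := M) hM.integrable (z := y * Complex.I)
        (ae_of_all _ fun ξ => by simp) hs
      rw [← h3, laplace, laplace]
      refine setIntegral_congr_fun measurableSet_Ioi fun t ht => ?_
      rw [hu.fourierSigned_eq_fourierSigned_one hν0 hν ht, hM.fourierSigned_eq]
      congr 2
      ext ξ
      push_cast
      congr 2
      ring)
  have m0 : MeasurableSet {p : ℝ × ℝ | 0 ≤ p.1 ^ (β / ν) * p.2} :=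
    measurable_scaled (β / ν) measurableSet_Ici
  rwa [restrict_prod_eq (S := Ici 0) (fun p hp => by
    simp [Real.rpow_pos_of_pos hp]) m0] at main

/-- As z → +∞ the Laplace transform tends to the mass on t^{β/ν} ξ = 0, which for s = 1 is the mass
at ξ = 0 times ∫ e^{-t} dt = 1, while the explicit resolvent tends to 0. -/
lemma integral_singleton_eq_zero [SFinite M] (hu : IsFundamentalSolution ν (-ν) β u)
    (hν0 : 0 < ν) (hν1 : ν ≤ 1) (hM : IsWeighted (u 1) M h) :
    ∫ ξ in {0}, h ξ ∂M = 0 := by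
  have hint := integrable_exp_smul_prod (M := M.restrict (Ici 0)) hM.integrable.restrict one_pos
  have hX0 : ∀ᵐ p ∂((volume.restrict (Ioi (0 : ℝ))).prod (M.restrict (Ici 0))),
      0 ≤ p.1 ^ (β / ν) * p.2 := by
    have hfst : ∀ᵐ p ∂((volume.restrict (Ioi (0 : ℝ))).prod (M.restrict (Ici 0))), 0 < p.1 :=
      Measure.quasiMeasurePreserving_fst.ae (p := fun t : ℝ => 0 < t)
        ((ae_restrict_iff' measurableSet_Ioi).2 (ae_of_all _ fun t ht => ht))
    have hsnd : ∀ᵐ p ∂((volume.restrict (Ioi (0 : ℝ))).prod (M.restrict (Ici 0))), 0 ≤ p.2 :=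
      Measure.quasiMeasurePreserving_snd.ae (p := fun t : ℝ => 0 ≤ t)
        ((ae_restrict_iff' measurableSet_Ici).2 (ae_of_all _ fun t ht => ht))
    filter_upwards [hfst, hsnd] with p h1 h2
    exact mul_nonneg (Real.rpow_nonneg h1.le _) h2
  have hlim := tendsto_integral_exp_neg_mul_atTop (measurable_scaled (β / ν)) hX0 hint
  have hres := tendsto_resolvent_atTop (s := 1) (β := β) hν0
  have heq := tendsto_nhds_unique (hlim.congr' (by
    filter_upwards [eventually_ge_atTop 0] with x hx
    exact hu.laplace_halfline_part hν0 hν1 hM one_pos x (by simpa using hx))) hres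
  have m0 : MeasurableSet {p : ℝ × ℝ | p.1 ^ (β / ν) * p.2 = 0} :=
    measurable_scaled (β / ν) (measurableSet_singleton 0)
  rw [restrict_prod_eq (S := {0}) (fun p hp => by
      simp [(Real.rpow_pos_of_pos hp (β / ν)).ne']) m0,
    Measure.restrict_restrict (measurableSet_singleton _),
    inter_eq_left.2 (by simp), integral_complex_ofReal,
    integral_prod_mul (fun t : ℝ => Real.exp (-(1 * t))) h] at heq
  have hexp : ∫ t in Ioi (0 : ℝ), Real.exp (-(1 * t)) = 1 := by
    simpa using integral_exp_neg_Ioi_zero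
  rw [hexp, one_mul] at heq
  exact_mod_cast heq

/-- The fundamental solution with extremal asymmetry does not charge the origin. -/
lemma setIntegral_Ici_eq_setIntegral_Ioi [SFinite M] (hu : IsFundamentalSolution ν (-ν) β u)
    (hν0 : 0 < ν) (hν1 : ν ≤ 1) (hM : IsWeighted (u 1) M h) {f : ℝ → ℂ} (hf : Measurable f)
    {C : ℝ} (hC : ∀ x, ‖f x‖ ≤ C) :
    ∫ ξ in Ici 0, h ξ • f ξ ∂M = ∫ ξ in Ioi 0, h ξ • f ξ ∂M := by
  have hi := integrable_smul_of_bounded hM.integrable hf.stronglyMeasurable hC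
  rw [← Ioi_union_left, setIntegral_union (by simp) (measurableSet_singleton 0)
    hi.integrableOn hi.integrableOn]
  have : ∫ ξ in {0}, h ξ • f ξ ∂M = ∫ ξ in {0}, h ξ • f 0 ∂M :=
    setIntegral_congr_fun (measurableSet_singleton 0) fun ξ hξ => by
      rw [mem_singleton_iff] at hξ
      simp [hξ]
  rw [this, integral_smul_const, hu.integral_singleton_eq_zero hν0 hν1 hM, zero_smul, add_zero]

/-- The spatial Laplace transform of the fundamental solution with extremal asymmetry. -/
lemma laplace_laplace [SFinite M] (hu : IsFundamentalSolution ν (-ν) β u)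
    (hν0 : 0 < ν) (hν1 : ν ≤ 1) (hM : IsWeighted (u 1) M h) {s : ℝ} (hs : 0 < s)
    {z : ℂ} (hz : 0 ≤ z.re) :
    laplace (fun t : ℝ => ∫ ξ in Ioi 0, h ξ • Complex.exp (-(z * (t ^ (β / ν) * ξ : ℝ))) ∂M) s
      = ((s ^ (β - 1) : ℝ) : ℂ) / ((s ^ β : ℝ) + z ^ (ν : ℂ)) := by
  rw [← hu.laplace_halfline_part hν0 hν1 hM hs z hz, ← laplace_scaledLaplace
    hM.integrable.restrict ((ae_restrict_iff' measurableSet_Ici).2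
      (ae_of_all _ fun ξ hξ => mul_nonneg hz hξ)) hs, laplace, laplace]
  refine setIntegral_congr_fun measurableSet_Ioi fun t ht => ?_
  congr 1
  -- The exponential may be unbounded for ξ < 0; replacing ξ by max ξ 0 gives a bounded test
  -- function on the whole line without changing it on the half-line.
  have key := hu.setIntegral_Ici_eq_setIntegral_Ioi hν0 hν1 hM
    (f := fun ξ => Complex.exp (-(z * (t ^ (β / ν) * max ξ 0 : ℝ)))) (by fun_prop) (C := 1)
    (fun ξ => norm_exp_neg_mul_le hz
      (mul_nonneg (Real.rpow_nonneg (le_of_lt ht) _) (le_max_right _ _)))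
  refine Eq.trans ?_ (key.symm.trans ?_)
  · exact setIntegral_congr_fun measurableSet_Ioi fun ξ hξ => by
      rw [max_eq_left (le_of_lt (mem_Ioi.1 hξ))]
  · exact setIntegral_congr_fun measurableSet_Ici fun ξ hξ => by
      rw [max_eq_left (mem_Ici.1 hξ)]

/-- Integrals over the half-line at time `t`, by self-similarity. -/
lemma setIntegral_Ioi_scaling {α θ : ℝ} (hu : IsFundamentalSolution α θ β u)
    (hα : 0 < α) (hθ : |θ| ≤ 1) (hM : IsWeighted (u 1) M h) {t : ℝ} (ht : 0 < t)
    {N : Measure ℝ} {g : ℝ → ℝ} (hN : IsWeighted (u t) N g) {f : ℝ → ℂ} (hf : Measurable f)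
    {C : ℝ} (hC : ∀ x, 0 < x → ‖f x‖ ≤ C) :
    ∫ ξ in Ioi 0, g ξ • f ξ ∂N = ∫ ξ in Ioi 0, h ξ • f (t ^ (β / α) * ξ) ∂M := by
  have hc : 0 < t ^ (β / α) := Real.rpow_pos_of_pos ht _
  have hC0 : 0 ≤ C := (norm_nonneg _).trans (hC 1 one_pos)
  have key := integral_comp_smul_eq_of_charFun (X := id) (Y := fun ξ => t ^ (β / α) * ξ)
    measurable_id (by fun_prop) hN.integrable hM.integrable (fun κ => by
      simp only [id]
      rw [← hN.fourierSigned_eq, hu.fourierSigned_eq_fourierSigned_one hα hθ ht,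
        hM.fourierSigned_eq]
      congr 1
      ext ξ
      push_cast
      ring_nf) (f := (Ioi 0).indicator f) (hf.indicator measurableSet_Ioi) (C := C)
    (fun x => by
      by_cases hx : x ∈ Ioi 0
      · simpa [hx] using hC x hx
      · simpa [hx] using hC0)
  rw [← integral_indicator measurableSet_Ioi, ← integral_indicator measurableSet_Ioi]
  refine Eq.trans ?_ (key.trans ?_)
  · congr 1
    ext ξ
    by_cases hx : 0 < ξ <;> simp [hx]
  · congr 1
    ext ξ
    by_cases hx : 0 < ξ <;> simp [hx, hc]

/-- The subordination formula on the Fourier side. -/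
lemma fourierSigned_eq_setIntegral {η γ : ℝ} {K : ℝ → SignedMeasure ℝ}
    (hu : IsFundamentalSolution ν (-ν) β u) (hν0 : 0 < ν) (hν1 : ν ≤ 1) (hη : 0 < η)
    (hγ : |γ| ≤ 1) (hK : IsFundamentalSolution (η * ν) (γ * ν) β K) {t : ℝ} (ht : 0 < t)
    {N : Measure ℝ} {g : ℝ → ℝ} (hN : IsWeighted (u t) N g) (κ : ℝ) :
    fourierSigned (K t) κ
      = ∫ ξ in Ioi 0, g ξ • Complex.exp (-(rieszFellerSymbol η γ κ * ξ)) ∂N := by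
  obtain ⟨M, h, _, _, hM⟩ := exists_isWeighted (u 1)
  have hz := rieszFellerSymbol_re_nonneg (α := η) hγ κ
  have hθ : |γ * ν| ≤ 1 := by
    rw [abs_mul, abs_of_pos hν0]
    exact mul_le_one₀ hγ hν0.le hν1
  rw [hu.setIntegral_Ioi_scaling hν0 (by rwa [abs_neg, abs_of_pos hν0]) hM ht hN
    (by fun_prop) fun x hx => norm_exp_neg_mul_le hz hx.le]
  have hzM : ∀ᵐ ξ ∂(M.restrict (Ioi 0)), 0 ≤ (rieszFellerSymbol η γ κ).re * ξ :=
    (ae_restrict_iff' measurableSet_Ioi).2 (ae_of_all _ fun ξ hξ => mul_nonneg hz (le_of_lt hξ))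
  -- Both sides are continuous in t, and their Laplace transforms agree at z = ψ_{η,γ}(κ) because
  -- z^ν is the symbol of K.
  refine eqOn_of_laplace_eq (f := fun t => fourierSigned (K t) κ)
    ((hK.continuousOn_fourierSigned κ).mono Ioi_subset_Ici_self)
    (continuousOn_scaledLaplace hM.integrable.restrict hzM) (hK.equation κ).converges
    (laplaceConverges_scaledLaplace hM.integrable.restrict hzM) (fun s hs => ?_) ht
  rw [hu.laplace_laplace hν0 hν1 hM hs hz, hK.laplace_fourierSigned hθ κ hs,
    rieszFellerSymbol_cpow hη hγ hν0]

end IsFundamentalSolution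

lemma norm_exp_mul_mul_I_le (κ x : ℝ) : ‖Complex.exp (κ * x * Complex.I)‖ ≤ 1 := by
  rw [← Complex.ofReal_mul, Complex.norm_exp_ofReal_mul_I]

lemma IsWeighted.ofReal_apply_eq {u : SignedMeasure ℝ} {M : Measure ℝ} {h : ℝ → ℝ}
    (hu : IsWeighted u M h) {B : Set ℝ} (hB : MeasurableSet B) :
    (u B : ℂ) = ∫ x, h x • B.indicator (fun _ => (1 : ℂ)) x ∂M := by
  rw [hu.apply_eq B hB, ← integral_complex_ofReal, ← integral_indicator hB]
  congr 1
  ext x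
  by_cases hx : x ∈ B <;> simp [hx]

lemma norm_indicator_one_le (B : Set ℝ) (x : ℝ) : ‖B.indicator (fun _ => (1 : ℂ)) x‖ ≤ 1 := by
  by_cases hx : x ∈ B <;> simp [hx]

/-! ### Subordination for Borel sets -/

namespace IsFundamentalSolution

variable {α θ β : ℝ} {u : ℝ → SignedMeasure ℝ} {M : Measure ℝ} {h : ℝ → ℝ}

lemma apply_eq_integral_scaled (hu : IsFundamentalSolution α θ β u) (hα : 0 < α) (hθ : |θ| ≤ 1)
    (hM : IsWeighted (u 1) M h) {t : ℝ} (ht : 0 < t) {B : Set ℝ} (hB : MeasurableSet B) :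
    u t B = ∫ x, h x * B.indicator (fun _ => (1 : ℝ)) (t ^ (β / α) * x) ∂M := by
  obtain ⟨N, g, _, _, hN⟩ := exists_isWeighted (u t)
  have key := integral_comp_smul_eq_of_charFun (X := id) (Y := fun ξ => t ^ (β / α) * ξ)
    measurable_id (by fun_prop) hN.integrable hM.integrable (fun κ => by
      simp only [id]
      rw [← hN.fourierSigned_eq, hu.fourierSigned_eq_fourierSigned_one hα hθ ht,
        hM.fourierSigned_eq]
      congr 1
      ext ξ
      push_cast
      ring_nf) (f := B.indicator fun _ => (1 : ℂ)) (measurable_const.indicator hB)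
    (norm_indicator_one_le B)
  have h1 := (hN.ofReal_apply_eq hB).trans key
  apply Complex.ofReal_injective
  rw [h1, ← integral_complex_ofReal]
  congr 1
  ext x
  by_cases hx : t ^ (β / α) * x ∈ B <;> simp [hx]

/-- Self-similarity writes the mass of `B` as an integral, against one fixed measure, of a jointly
measurable function. The resulting measurability and uniform bound give absolute convergence of the
subordination integral. -/
lemma exists_measurable_eq_apply (hu : IsFundamentalSolution α θ β u) (hα : 0 < α)
    (hθ : |θ| ≤ 1) {B : Set ℝ} (hB : MeasurableSet B) :
    ∃ (Φ : ℝ → ℝ) (C : ℝ), Measurable Φ ∧ (∀ t, ‖Φ t‖ ≤ C) ∧ ∀ t, 0 < t → u t B = Φ t := by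
  obtain ⟨M, h, _, hh, hM⟩ := exists_isWeighted (u 1)
  refine ⟨fun t => ∫ x, h x * B.indicator (fun _ => (1 : ℝ)) (t ^ (β / α) * x) ∂M,
    ∫ x, ‖h x‖ ∂M, ?_, fun t => ?_, fun t ht => hu.apply_eq_integral_scaled hα hθ hM ht hB⟩
  · refine StronglyMeasurable.measurable (StronglyMeasurable.integral_prod_right
      (f := fun t x => h x * B.indicator (fun _ => (1 : ℝ)) (t ^ (β / α) * x)) ?_)
    refine Measurable.stronglyMeasurable ?_
    have h1 : Measurable (B.indicator fun _ => (1 : ℝ)) := measurable_const.indicator hB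
    exact (hh.comp measurable_snd).mul (h1.comp (measurable_scaled (β / α)))
  · refine norm_integral_le_of_norm_le hM.integrable.norm (ae_of_all _ fun x => ?_)
    rw [norm_mul]
    refine mul_le_of_le_one_right (norm_nonneg _) ?_
    by_cases hx : t ^ (β / α) * x ∈ B <;> simp [hx]

/-- The subordination formula for the measures of Borel sets, for any weight of `u t`. -/
lemma apply_eq_setIntegral {η γ ν : ℝ} {K L : ℝ → SignedMeasure ℝ}
    (hu : IsFundamentalSolution ν (-ν) β u) (hν0 : 0 < ν) (hν1 : ν ≤ 1) (hη : 0 < η)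
    (hγ : |γ| ≤ 1) (hK : IsFundamentalSolution (η * ν) (γ * ν) β K)
    (hL : IsFundamentalSolution η γ 1 L) {t : ℝ} (ht : 0 < t)
    {N : Measure ℝ} [SFinite N] {g : ℝ → ℝ} (hN : IsWeighted (u t) N g)
    {B : Set ℝ} (hB : MeasurableSet B) : K t B = ∫ ξ in Ioi 0, g ξ * L ξ B ∂N := by
  obtain ⟨M, h, _, _, hM⟩ := exists_isWeighted (K t)
  obtain ⟨P, l, _, _, hP⟩ := exists_isWeighted (L 1)
  have hgl : Integrable (fun p : ℝ × ℝ => g p.1 * l p.2) ((N.restrict (Ioi 0)).prod P) :=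
    hN.integrable.restrict.mul_prod hP.integrable
  have hiter : ∀ {f : ℝ → ℂ}, Measurable f → (∀ x, ‖f x‖ ≤ 1) →
      ∫ p, (g p.1 * l p.2) • f (p.1 ^ (1 / η) * p.2) ∂((N.restrict (Ioi 0)).prod P)
        = ∫ ξ in Ioi 0, g ξ • ∫ x, l x • f (ξ ^ (1 / η) * x) ∂P ∂N := by
    intro f hf hf1
    rw [integral_prod _ (integrable_smul_of_bounded hgl
      (G := fun p => f (p.1 ^ (1 / η) * p.2))
      (hf.comp (measurable_scaled (1 / η))).stronglyMeasurable fun p => hf1 _)]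
    congr 1
    ext ξ
    rw [← integral_smul]
    congr 1
    ext x
    rw [mul_smul]
  -- The mixture is the image of the product weight g(ξ) l(x) under (ξ,x) ↦ ξ^{1/η} x, which is
  -- self-similarity of L. Its characteristic function is that of K at time t.
  have key := integral_comp_smul_eq_of_charFun measurable_id (measurable_scaled (1 / η))
    hM.integrable hgl (fun κ => by
      rw [hiter (f := fun x => Complex.exp (κ * x * Complex.I)) (by fun_prop)
        (norm_exp_mul_mul_I_le κ)]
      simp only [id]
      rw [← hM.fourierSigned_eq, hu.fourierSigned_eq_setIntegral hν0 hν1 hη hγ hK ht hN κ]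
      refine setIntegral_congr_fun measurableSet_Ioi fun ξ hξ => ?_
      rw [← hL.fourierSigned_eq_exp hγ hξ, hL.fourierSigned_eq_fourierSigned_one hη hγ hξ,
        hP.fourierSigned_eq]
      congr 2
      ext x
      push_cast
      ring_nf) (f := B.indicator fun _ => (1 : ℂ)) (measurable_const.indicator hB)
    (norm_indicator_one_le B)
  rw [hiter (measurable_const.indicator hB) (norm_indicator_one_le B)] at key
  apply Complex.ofReal_injective
  rw [hM.ofReal_apply_eq hB, ← integral_complex_ofReal]
  refine key.trans (setIntegral_congr_fun measurableSet_Ioi fun ξ hξ => ?_)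
  rw [hL.apply_eq_integral_scaled hη hγ hP hξ hB, Complex.ofReal_mul, Complex.real_smul,
    ← integral_complex_ofReal]
  congr 2
  ext x
  by_cases hx : ξ ^ (1 / η) * x ∈ B
  · simp only [indicator_of_mem hx]
    simp
  · simp only [indicator_of_notMem hx]
    simp

end IsFundamentalSolution

/-- The subordination formula for the measures of Borel sets. -/
lemma integrableOn_and_apply_eq_integral {β η γ ν : ℝ} {K L K' : ℝ → SignedMeasure ℝ}
    (hK' : IsFundamentalSolution ν (-ν) β K') (hν0 : 0 < ν) (hν1 : ν ≤ 1) (hη : 0 < η)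
    (hγ : |γ| ≤ 1) (hK : IsFundamentalSolution (η * ν) (γ * ν) β K)
    (hL : IsFundamentalSolution η γ 1 L) {t : ℝ} (ht : 0 < t)
    {B : Set ℝ} (hB : MeasurableSet B) :
    (K' t).IntegrableOn (fun ξ => L ξ B) (Ioi 0) ∧
      K t B = ((K' t).restrict (Ioi 0)).integral (fun ξ => L ξ B)
        (ContinuousLinearMap.lsmul ℝ ℝ) := by
  obtain ⟨N, g, _, _, hN⟩ := exists_isWeighted (K' t)
  obtain ⟨Φ, C, hΦ, hC, heq⟩ := hL.exists_measurable_eq_apply hη hγ hB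
  have fin := isFiniteMeasure_variation (K' t)
  constructor
  · rw [VectorMeasure.IntegrableOn, VectorMeasure.Integrable,
      VectorMeasure.variation_restrict measurableSet_Ioi]
    refine (Integrable.mono' (integrable_const C) hΦ.aestronglyMeasurable
      (ae_of_all _ hC)).congr ?_
    exact (ae_restrict_iff' measurableSet_Ioi).2 (ae_of_all _ fun ξ hξ => (heq ξ hξ).symm)
  · rw [hK'.apply_eq_setIntegral hν0 hν1 hη hγ hK hL ht hN hB,
      VectorMeasure.setIntegral_congr_fun (g := Φ) (s := Ioi 0) (fun ξ hξ => heq ξ hξ),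
      (hN.restrict measurableSet_Ioi).integral_lsmul_eq hΦ hC]
    exact setIntegral_congr_fun measurableSet_Ioi fun ξ hξ => by
      rw [heq ξ hξ]

open scoped FourierTransform

/-! ### Oscillatory integrals -/

section Oscillatory

variable {b : ℂ} {η : ℝ}

lemma norm_exp_oscillatory (y w : ℝ) :
    ‖Complex.exp (Complex.I * y * w - b * (w ^ η : ℝ))‖ = Real.exp (-b.re * w ^ η) := by
  rw [Complex.norm_exp]
  congr 1
  rw [Complex.sub_re, Complex.re_mul_ofReal, Complex.re_mul_ofReal]
  simp

lemma continuous_exp_oscillatory (hη : 0 < η) (y : ℝ) :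
    Continuous fun w : ℝ => Complex.exp (Complex.I * y * w - b * (w ^ η : ℝ)) := by
  have : Continuous fun w : ℝ => w ^ η := Real.continuous_rpow_const hη.le
  fun_prop

lemma integrableOn_exp_oscillatory (hb : 0 < b.re) (hη : 0 < η) (y : ℝ) :
    IntegrableOn (fun w : ℝ => Complex.exp (Complex.I * y * w - b * (w ^ η : ℝ))) (Ioi 0) := by
  have h := integrableOn_rpow_mul_exp_neg_mul_rpow (s := 0) (by norm_num) hη hb
  simp only [Real.rpow_zero, one_mul] at h
  exact h.mono' (continuous_exp_oscillatory hη y).aestronglyMeasurable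
    (ae_of_all _ fun w => (norm_exp_oscillatory y w).le)

/-- Decay of an oscillatory integral, by integration by parts. -/
lemma norm_mul_integral_oscillatory_le (hb : 0 < b.re) (hη : 0 < η) (y : ℝ) :
    |y| * ‖∫ w in Ioi (0 : ℝ), Complex.exp (Complex.I * y * w - b * (w ^ η : ℝ))‖
      ≤ 1 + ‖b‖ / b.re := by
  set F : ℝ → ℂ := fun w => Complex.exp (Complex.I * y * w - b * (w ^ η : ℝ)) with hF
  have hFint : IntegrableOn F (Ioi 0) := integrableOn_exp_oscillatory hb hη y
  have hpow := integrableOn_rpow_mul_exp_neg_mul_rpow (s := η - 1) (by linarith) hη hb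
  have hG : ∀ w ∈ Ioi (0 : ℝ), ‖F w * (b * (η * w ^ (η - 1) : ℝ))‖
      = ‖b‖ * η * (w ^ (η - 1) * Real.exp (-b.re * w ^ η)) := by
    intro w hw
    have hw : 0 < w := hw
    rw [norm_mul, norm_exp_oscillatory, norm_mul, Complex.norm_real,
      Real.norm_of_nonneg (mul_nonneg hη.le (Real.rpow_nonneg hw.le _))]
    ring
  have hGint : IntegrableOn (fun w => F w * (b * (η * w ^ (η - 1) : ℝ))) (Ioi 0) := by
    refine (hpow.const_mul (‖b‖ * η)).mono' ?_ ((ae_restrict_iff' measurableSet_Ioi).2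
      (ae_of_all _ fun w hw => (hG w hw).le))
    exact (Measurable.stronglyMeasurable (by fun_prop)).aestronglyMeasurable
  have hderiv : ∀ w ∈ Ioi (0 : ℝ), HasDerivAt F
      (Complex.I * y * F w - F w * (b * (η * w ^ (η - 1) : ℝ))) w := by
    intro w hw
    have h1 : HasDerivAt (fun w : ℝ => (w : ℂ)) 1 w := (hasDerivAt_id w).ofReal_comp
    have h2 := (Real.hasDerivAt_rpow_const (x := w) (p := η) (Or.inl (ne_of_gt hw))).ofReal_comp
    have h3 := ((h1.const_mul (Complex.I * y)).fun_sub (h2.const_mul b)).cexp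
    convert h3 using 1
    simp only [hF]
    ring
  have hlim : Tendsto F atTop (𝓝 0) := by
    rw [tendsto_zero_iff_norm_tendsto_zero]
    simp only [hF, norm_exp_oscillatory]
    refine Real.tendsto_exp_atBot.comp ?_
    exact (tendsto_rpow_atTop hη).const_mul_atTop_of_neg (by linarith)
  have hFcont : Continuous F := continuous_exp_oscillatory hη y
  have hftc := integral_Ioi_of_hasDerivAt_of_tendsto hFcont.continuousWithinAt hderiv
    ((hFint.const_mul _).sub hGint) hlim
  rw [integral_sub (hFint.const_mul _) hGint, integral_const_mul] at hftc
  have hF0 : F 0 = 1 := by simp [hF, Real.zero_rpow hη.ne']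
  rw [hF0] at hftc
  -- Here ∫ η w^{η-1} e^{-Re b · w^η} dw = 1/Re b.
  have hbound : ‖∫ w in Ioi (0 : ℝ), F w * (b * (η * w ^ (η - 1) : ℝ))‖ ≤ ‖b‖ / b.re := by
    refine (norm_integral_le_integral_norm _).trans (le_of_eq ?_)
    rw [setIntegral_congr_fun measurableSet_Ioi hG, integral_const_mul,
      integral_rpow_mul_exp_neg_mul_rpow hη (by linarith) hb, sub_add_cancel, neg_div,
      div_self hη.ne', Real.Gamma_one, Real.rpow_neg_one]
    field_simp
  have heq : Complex.I * y * ∫ w in Ioi (0 : ℝ), F w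
      = -1 + ∫ w in Ioi (0 : ℝ), F w * (b * (η * w ^ (η - 1) : ℝ)) := by
    linear_combination hftc
  calc |y| * ‖∫ w in Ioi (0 : ℝ), F w‖ = ‖Complex.I * y * ∫ w in Ioi (0 : ℝ), F w‖ := by
        simp
    _ ≤ ‖(-1 : ℂ)‖ + ‖∫ w in Ioi (0 : ℝ), F w * (b * (η * w ^ (η - 1) : ℝ))‖ := by
        rw [heq]
        exact norm_add_le _ _
    _ ≤ 1 + ‖b‖ / b.re := by
        rw [norm_neg, norm_one]
        linarith

lemma integrable_of_integrableOn_Ioi {f : ℝ → ℂ} (h1 : IntegrableOn f (Ioi 0))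
    (h2 : IntegrableOn (fun x => f (-x)) (Ioi 0)) : Integrable f := by
  rw [← integrableOn_univ, ← Iic_union_Ioi (a := (0 : ℝ)), integrableOn_union]
  refine ⟨?_, h1⟩
  rw [← (Measure.measurePreserving_neg (volume : Measure ℝ)).integrableOn_comp_preimage
    (Homeomorph.neg ℝ).measurableEmbedding]
  simp only [Function.comp_def, neg_preimage, neg_Iic, neg_zero]
  rwa [integrableOn_Ici_iff_integrableOn_Ioi]

lemma integral_eq_integral_Ioi_add {f : ℝ → ℂ} (h : Integrable f) :
    ∫ x, f x = (∫ x in Ioi 0, f (-x)) + ∫ x in Ioi 0, f x := by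
  rw [integral_comp_neg_Ioi 0 f, neg_zero,
    intervalIntegral.integral_Iic_add_Ioi h.integrableOn h.integrableOn]

end Oscillatory

/-! ### Stable densities by Fourier inversion -/

lemma measurable_rieszFellerSymbol (α θ : ℝ) : Measurable (rieszFellerSymbol α θ) := by
  have hs : Measurable Real.sign := by
    unfold Real.sign
    exact Measurable.ite measurableSet_Iio measurable_const
      (Measurable.ite measurableSet_Ioi measurable_const measurable_const)
  unfold rieszFellerSymbol
  have : Measurable fun κ : ℝ => |κ| := measurable_id.abs
  fun_prop

/-- The inverse Fourier transform of the characteristic function of a stable law. -/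
noncomputable def stableDensity (η γ x ξ : ℝ) : ℂ :=
  ∫ w : ℝ, Complex.exp ((2 * Real.pi * (w * x) : ℝ) * Complex.I) •
    Complex.exp (-(rieszFellerSymbol η γ (-2 * Real.pi * w) * ξ))

lemma measurable_stableDensity (η γ : ℝ) :
    Measurable fun p : ℝ × ℝ => stableDensity η γ p.1 p.2 := by
  refine StronglyMeasurable.measurable (StronglyMeasurable.integral_prod_right
    (f := fun (p : ℝ × ℝ) (w : ℝ) => Complex.exp ((2 * Real.pi * (w * p.1) : ℝ) * Complex.I) •
      Complex.exp (-(rieszFellerSymbol η γ (-2 * Real.pi * w) * p.2))) ?_)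
  refine Measurable.stronglyMeasurable ?_
  have h1 : Measurable fun q : (ℝ × ℝ) × ℝ => rieszFellerSymbol η γ (-2 * Real.pi * q.2) :=
    (measurable_rieszFellerSymbol η γ).comp (by fun_prop)
  simp only [smul_eq_mul, Function.uncurry_def]
  fun_prop

section StableDensity

variable {η γ : ℝ}

/-- The coefficient of `w ^ η` in the exponent of the stable characteristic function. -/
lemma rieszFellerSymbol_two_pi (e : ℝ) {w : ℝ} (hw : 0 < w) :
    rieszFellerSymbol η γ (-2 * Real.pi * (e * w))
      = ((2 * Real.pi) ^ η : ℝ) * rieszFellerSymbol η γ (-e) * (w ^ η : ℝ) := by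
  have h2 : 0 < 2 * Real.pi * w := by positivity
  rw [show -2 * Real.pi * (e * w) = 2 * Real.pi * w * -e by ring, rieszFellerSymbol_mul h2,
    Real.mul_rpow (by positivity) hw.le]
  push_cast
  ring

lemma cos_pos_of_abs_lt_one (hγ : |γ| < 1) : 0 < Real.cos (γ * Real.pi / 2) := by
  have := abs_lt.1 hγ
  have hpi := Real.pi_pos
  exact Real.cos_pos_of_mem_Ioo ⟨by nlinarith, by nlinarith⟩

lemma rieszFellerSymbol_unit_re {e : ℝ} (he : e = 1 ∨ e = -1) :
    (rieszFellerSymbol η γ (-e)).re = Real.cos (γ * Real.pi / 2) := by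
  rw [rieszFellerSymbol_re]
  rcases he with rfl | rfl
  · rw [Real.sign_of_neg (by norm_num)]
    rw [← Real.cos_neg (γ * Real.pi / 2), abs_neg, abs_one, Real.one_rpow, one_mul]
    ring_nf
  · rw [Real.sign_of_pos (by norm_num)]
    simp

lemma norm_rieszFellerSymbol_unit {e : ℝ} (he : e = 1 ∨ e = -1) :
    ‖rieszFellerSymbol η γ (-e)‖ = 1 := by
  rw [rieszFellerSymbol, norm_mul, mul_comm Complex.I, Complex.norm_exp_ofReal_mul_I]
  rcases he with rfl | rfl <;> simp

lemma stable_integrand_eq (e x ξ : ℝ) {w : ℝ}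
    (hw : w ∈ Ioi (0 : ℝ)) :
    Complex.exp ((2 * Real.pi * (e * w * x) : ℝ) * Complex.I) •
      Complex.exp (-(rieszFellerSymbol η γ (-2 * Real.pi * (e * w)) * ξ))
      = Complex.exp (Complex.I * (2 * Real.pi * e * x : ℝ) * w
        - (((2 * Real.pi) ^ η * ξ : ℝ) * rieszFellerSymbol η γ (-e)) * (w ^ η : ℝ)) := by
  rw [rieszFellerSymbol_two_pi e hw, smul_eq_mul, ← Complex.exp_add]
  congr 1
  push_cast
  ring

lemma stable_coefficient_re_pos (hγ : |γ| < 1) {e : ℝ} (he : e = 1 ∨ e = -1) {ξ : ℝ}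
    (hξ : 0 < ξ) :
    0 < (((2 * Real.pi) ^ η * ξ : ℝ) * rieszFellerSymbol η γ (-e)).re := by
  rw [Complex.re_ofReal_mul, rieszFellerSymbol_unit_re he]
  have := cos_pos_of_abs_lt_one hγ
  have : 0 < (2 * Real.pi) ^ η := Real.rpow_pos_of_pos (by positivity) _
  positivity

lemma integrable_stable_integrand (hη : 0 < η) (hγ : |γ| < 1) {ξ : ℝ} (hξ : 0 < ξ) (x : ℝ) :
    Integrable fun w : ℝ => Complex.exp ((2 * Real.pi * (w * x) : ℝ) * Complex.I) •
      Complex.exp (-(rieszFellerSymbol η γ (-2 * Real.pi * w) * ξ)) := by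
  have key : ∀ e : ℝ, (e = 1 ∨ e = -1) → IntegrableOn (fun w : ℝ =>
      Complex.exp ((2 * Real.pi * (e * w * x) : ℝ) * Complex.I) •
      Complex.exp (-(rieszFellerSymbol η γ (-2 * Real.pi * (e * w)) * ξ))) (Ioi 0) := fun e he =>
    (integrableOn_exp_oscillatory (stable_coefficient_re_pos hγ he hξ) hη _).congr_fun
      (fun w hw => (stable_integrand_eq e x ξ hw).symm) measurableSet_Ioi
  refine integrable_of_integrableOn_Ioi ?_ ?_
  · simpa only [one_mul] using key 1 (Or.inl rfl)
  · simpa only [neg_one_mul] using key (-1) (Or.inr rfl)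

/-- On each half-line the coefficient of w^η is a positive multiple of a unit complex number with
real part cos(γπ/2). The ratio ‖b‖/Re b in the oscillatory bound therefore does not depend on ξ. -/
lemma abs_mul_norm_stableDensity_le (hη : 0 < η) (hγ : |γ| < 1) {ξ : ℝ} (hξ : 0 < ξ) (x : ℝ) :
    |x| * ‖stableDensity η γ x ξ‖
      ≤ (1 + 1 / Real.cos (γ * Real.pi / 2)) / Real.pi := by
  have hpi := Real.pi_pos
  have key : ∀ e : ℝ, (e = 1 ∨ e = -1) → 2 * Real.pi * |x| * ‖∫ w in Ioi (0 : ℝ),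
      Complex.exp ((2 * Real.pi * (e * w * x) : ℝ) * Complex.I) •
      Complex.exp (-(rieszFellerSymbol η γ (-2 * Real.pi * (e * w)) * ξ))‖
      ≤ 1 + 1 / Real.cos (γ * Real.pi / 2) := by
    intro e he
    have h := norm_mul_integral_oscillatory_le (stable_coefficient_re_pos (η := η) hγ he hξ) hη
      (2 * Real.pi * e * x)
    have hc : 0 < (2 * Real.pi) ^ η * ξ := mul_pos (Real.rpow_pos_of_pos (by positivity) _) hξ
    have he1 : |e| = 1 := by rcases he with rfl | rfl <;> simp
    rw [norm_mul, Complex.norm_real, Real.norm_of_nonneg hc.le, Complex.re_ofReal_mul,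
      rieszFellerSymbol_unit_re he, norm_rieszFellerSymbol_unit he,
      mul_div_mul_left _ _ hc.ne', abs_mul, abs_mul, he1, mul_one,
      abs_of_pos (by positivity : 0 < 2 * Real.pi)] at h
    rwa [setIntegral_congr_fun measurableSet_Ioi fun w hw => stable_integrand_eq e x ξ hw]
  have h1 := key 1 (Or.inl rfl)
  have h2 := key (-1) (Or.inr rfl)
  simp only [one_mul] at h1
  simp only [neg_one_mul] at h2
  rw [stableDensity, integral_eq_integral_Ioi_add (integrable_stable_integrand hη hγ hξ x),
    le_div_iff₀ hpi]
  have h3 := mul_le_mul_of_nonneg_left (norm_add_le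
    (∫ w in Ioi (0 : ℝ), Complex.exp ((2 * Real.pi * (-w * x) : ℝ) * Complex.I) •
      Complex.exp (-(rieszFellerSymbol η γ (-2 * Real.pi * -w) * ξ)))
    (∫ w in Ioi (0 : ℝ), Complex.exp ((2 * Real.pi * (w * x) : ℝ) * Complex.I) •
      Complex.exp (-(rieszFellerSymbol η γ (-2 * Real.pi * w) * ξ))))
    (by positivity : 0 ≤ 2 * Real.pi * |x|)
  linarith

end StableDensity

namespace HasDensity

variable {u : ℝ → SignedMeasure ℝ} {k : ℝ → ℝ → ℝ}

lemma isWeighted (hk : HasDensity u k) {t : ℝ} (ht : 0 < t) :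
    IsWeighted (u t) volume fun x => k x t where
  integrable := hk.integrable t ht
  apply_eq B hB := by
    rw [hk.eq_withDensity t ht, withDensityᵥ_apply (hk.integrable t ht) hB]

lemma fourier_eq (hk : HasDensity u k) {t : ℝ} (ht : 0 < t) (w : ℝ) :
    𝓕 (fun x => (k x t : ℂ)) w = fourierSigned (u t) (-2 * Real.pi * w) := by
  rw [Real.fourier_real_eq_integral_exp_smul, (hk.isWeighted ht).fourierSigned_eq]
  congr 1
  ext x
  rw [smul_eq_mul, Complex.real_smul, mul_comm]
  push_cast
  ring_nf

variable {η γ : ℝ} {L : ℝ → SignedMeasure ℝ} {l : ℝ → ℝ → ℝ}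

/-- For |γ| = 1 the symbol is purely imaginary, so the transform of L has modulus 1 everywhere,
which the Riemann–Lebesgue lemma forbids for an integrable density. -/
lemma abs_lt_one (hl : HasDensity L l) (hL : IsFundamentalSolution η γ 1 L) (hη : 0 < η)
    (hγ : |γ| ≤ 1) : |γ| < 1 := by
  refine lt_of_le_of_ne hγ fun h1 => ?_
  have hone : ∀ w : ℝ, ‖𝓕 (fun x => (l x 1 : ℂ)) w‖ = 1 := by
    intro w
    rw [hl.fourier_eq one_pos, hL.fourierSigned_eq_exp hγ one_pos, Complex.norm_exp]
    have hre : (rieszFellerSymbol η γ (-2 * Real.pi * w)).re = 0 := by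
      rcases eq_or_ne w 0 with hw | hw
      · rw [hw, mul_zero, rieszFellerSymbol_zero hη.ne', Complex.zero_re]
      rw [rieszFellerSymbol_re]
      have hs : |Real.sign (-2 * Real.pi * w) * γ| = 1 := by
        have hne : -2 * Real.pi * w ≠ 0 := mul_ne_zero (by simp [Real.pi_ne_zero]) hw
        rw [abs_mul, h1, mul_one]
        rcases Real.sign_apply_eq_of_ne_zero _ hne with h | h <;> rw [h] <;> simp
      have : Real.cos (Real.sign (-2 * Real.pi * w) * γ * Real.pi / 2) = 0 := by
        rcases (abs_eq one_pos.le).1 hs with h | h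
        · rw [h, one_mul, Real.cos_pi_div_two]
        · rw [h, neg_one_mul, neg_div, Real.cos_neg, Real.cos_pi_div_two]
      rw [this, mul_zero]
    rw [Complex.neg_re, Complex.re_mul_ofReal, hre, zero_mul, neg_zero, Real.exp_zero]
  have hRL : Tendsto (fun w : ℝ => 𝓕 (fun x => (l x 1 : ℂ)) w) (cocompact ℝ) (𝓝 0) := by
    simp only [Real.fourier_real_eq]
    exact Real.tendsto_integral_exp_smul_cocompact _
  have := hRL.norm
  simp only [hone, norm_zero] at this
  exact one_ne_zero (tendsto_nhds_unique this tendsto_const_nhds).symm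

/-- Fourier inversion for the stable densities. -/
lemma eq_stableDensity (hl : HasDensity L l) (hL : IsFundamentalSolution η γ 1 L) (hη : 0 < η)
    (hγ : |γ| < 1) {x ξ : ℝ} (hx : x ≠ 0) (hξ : 0 < ξ) :
    (l x ξ : ℂ) = stableDensity η γ x ξ := by
  have hF : 𝓕 (fun x => (l x ξ : ℂ))
      = fun w => Complex.exp (-(rieszFellerSymbol η γ (-2 * Real.pi * w) * ξ)) := by
    ext w
    rw [hl.fourier_eq hξ, hL.fourierSigned_eq_exp hγ.le hξ]
  have hFi : Integrable (𝓕 (fun x => (l x ξ : ℂ))) := by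
    rw [hF]
    simpa using integrable_stable_integrand hη hγ hξ 0
  have hcont : ContinuousAt (fun x => (l x ξ : ℂ)) x :=
    Complex.continuous_ofReal.continuousAt.comp
      ((hl.continuousOn ξ hξ).continuousAt (isOpen_compl_singleton.mem_nhds hx))
  have := (hl.integrable ξ hξ).ofReal.fourierInv_fourier_eq hFi hcont
  refine Eq.trans this.symm ?_
  rw [Real.fourierInv_eq', stableDensity]
  simp only [hF]
  congr 1
  ext w
  simp [mul_comm]

end HasDensity

/-- A continuous function on the half-line is zero if its integrals over intervals vanish. -/
lemma eqOn_zero_of_forall_intervalIntegral_eq_zero {f : ℝ → ℝ} (hf : ContinuousOn f (Ioi 0))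
    (h0 : ∀ a b, 0 < a → a ≤ b → ∫ x in a..b, f x = 0) : EqOn f 0 (Ioi 0) := by
  intro x hx
  have hx : 0 < x := hx
  have hd : HasDerivAt (fun u => ∫ y in x..u, f y) (f x) x :=
    intervalIntegral.integral_hasDerivAt_right (by simp)
      (hf.stronglyMeasurableAtFilter isOpen_Ioi x hx) (hf.continuousAt (Ioi_mem_nhds hx))
  have hz : (fun u => ∫ y in x..u, f y) =ᶠ[𝓝 x] fun _ => 0 := by
    filter_upwards [Ioi_mem_nhds hx] with u hu
    rcases le_total x u with h | h
    · exact h0 x u hx h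
    · rw [intervalIntegral.integral_symm, h0 u x hu h, neg_zero]
  exact hd.unique ((hasDerivAt_const x (0 : ℝ)).congr_of_eventuallyEq hz)

/-! ### Subordination for densities -/

section Densities

variable {η γ : ℝ} {L : ℝ → SignedMeasure ℝ} {l : ℝ → ℝ → ℝ} {m : ℝ → ℝ}

/-- Uniformity in ξ is the point: integrability of the subordinating density then suffices for
absolute convergence, continuity in x and Fubini. -/
lemma HasDensity.exists_abs_le_div (hl : HasDensity L l) (hL : IsFundamentalSolution η γ 1 L)
    (hη : 0 < η) (hγ : |γ| ≤ 1) :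
    ∃ C, 0 ≤ C ∧ ∀ x ξ : ℝ, 0 < x → 0 < ξ → |l x ξ| ≤ C / x := by
  have hγ1 := hl.abs_lt_one hL hη hγ
  have hc := cos_pos_of_abs_lt_one hγ1
  have hpi := Real.pi_pos
  refine ⟨(1 + 1 / Real.cos (γ * Real.pi / 2)) / Real.pi, by positivity, fun x ξ hx hξ => ?_⟩
  have h1 := abs_mul_norm_stableDensity_le hη hγ1 hξ x
  rwa [← hl.eq_stableDensity hL hη hγ1 hx.ne' hξ, Complex.norm_real, Real.norm_eq_abs,
    abs_of_pos hx, mul_comm, ← le_div_iff₀ hx] at h1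

lemma HasDensity.aestronglyMeasurable_section (hl : HasDensity L l)
    (hL : IsFundamentalSolution η γ 1 L) (hη : 0 < η) (hγ : |γ| ≤ 1) {x : ℝ} (hx : 0 < x) :
    AEStronglyMeasurable (fun ξ => l x ξ) (volume.restrict (Ioi 0)) := by
  have h1 : Measurable fun ξ => (stableDensity η γ x ξ).re :=
    Complex.measurable_re.comp ((measurable_stableDensity η γ).comp measurable_prodMk_left)
  refine h1.aestronglyMeasurable.congr ((ae_restrict_iff' measurableSet_Ioi).2
    (ae_of_all _ fun ξ hξ => ?_))
  beta_reduce
  rw [← hl.eq_stableDensity hL hη (hl.abs_lt_one hL hη hγ) hx.ne' hξ, Complex.ofReal_re]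

lemma norm_density_mul_le {C : ℝ} (hC : ∀ x ξ : ℝ, 0 < x → 0 < ξ → |l x ξ| ≤ C / x) {x : ℝ}
    (hx : 0 < x) : ∀ᵐ ξ ∂(volume.restrict (Ioi (0 : ℝ))), ‖l x ξ * m ξ‖ ≤ C / x * ‖m ξ‖ := by
  refine (ae_restrict_iff' measurableSet_Ioi).2 (ae_of_all _ fun ξ hξ => ?_)
  rw [norm_mul]
  exact mul_le_mul_of_nonneg_right (hC x ξ hx hξ) (norm_nonneg _)

lemma HasDensity.integrableOn_mul (hl : HasDensity L l) (hL : IsFundamentalSolution η γ 1 L)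
    (hη : 0 < η) (hγ : |γ| ≤ 1) (hm : Integrable m) {x : ℝ} (hx : 0 < x) :
    IntegrableOn (fun ξ => l x ξ * m ξ) (Ioi 0) := by
  obtain ⟨C, _, hC⟩ := hl.exists_abs_le_div hL hη hγ
  exact (hm.restrict.norm.const_mul (C / x)).mono'
    ((hl.aestronglyMeasurable_section hL hη hγ hx).mul hm.restrict.aestronglyMeasurable)
    (norm_density_mul_le hC hx)

lemma HasDensity.continuousOn_integral_mul (hl : HasDensity L l)
    (hL : IsFundamentalSolution η γ 1 L) (hη : 0 < η) (hγ : |γ| ≤ 1) (hm : Integrable m) :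
    ContinuousOn (fun x => ∫ ξ in Ioi 0, l x ξ * m ξ) (Ioi 0) := by
  obtain ⟨C, hC0, hC⟩ := hl.exists_abs_le_div hL hη hγ
  intro x hx
  have hx : 0 < x := hx
  refine ContinuousAt.continuousWithinAt (continuousAt_of_dominated
    (bound := fun ξ => C / (x / 2) * ‖m ξ‖) ?_ ?_ (hm.restrict.norm.const_mul _) ?_)
  · filter_upwards [Ioi_mem_nhds hx] with y hy
    exact (hl.integrableOn_mul hL hη hγ hm hy).aestronglyMeasurable
  · filter_upwards [Ioi_mem_nhds (half_lt_self hx)] with y hy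
    have hy : x / 2 < y := hy
    have hy0 : 0 < y := (half_pos hx).trans hy
    filter_upwards [norm_density_mul_le (m := m) hC hy0] with ξ hξ
    refine hξ.trans (mul_le_mul_of_nonneg_right ?_ (norm_nonneg _))
    exact div_le_div_of_nonneg_left hC0 (half_pos hx) hy.le
  · refine (ae_restrict_iff' measurableSet_Ioi).2 (ae_of_all _ fun ξ hξ => ?_)
    exact ((hl.continuousOn ξ hξ).continuousAt
      (isOpen_compl_singleton.mem_nhds hx.ne')).mul_const _

lemma HasDensity.integrable_mul_prod (hl : HasDensity L l) (hL : IsFundamentalSolution η γ 1 L)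
    (hη : 0 < η) (hγ : |γ| ≤ 1) (hm : Integrable m) {a b : ℝ} (ha : 0 < a) :
    Integrable (fun p : ℝ × ℝ => l p.1 p.2 * m p.2)
      ((volume.restrict (Ioc a b)).prod (volume.restrict (Ioi 0))) := by
  obtain ⟨C, hC0, hC⟩ := hl.exists_abs_le_div hL hη hγ
  have hfst : ∀ᵐ p ∂((volume.restrict (Ioc a b)).prod (volume.restrict (Ioi (0 : ℝ)))),
      a < p.1 := Measure.quasiMeasurePreserving_fst.ae (p := fun x : ℝ => a < x)
    ((ae_restrict_iff' measurableSet_Ioc).2 (ae_of_all _ fun x hx => hx.1))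
  have hsnd : ∀ᵐ p ∂((volume.restrict (Ioc a b)).prod (volume.restrict (Ioi (0 : ℝ)))),
      0 < p.2 := Measure.quasiMeasurePreserving_snd.ae (p := fun x : ℝ => 0 < x)
    ((ae_restrict_iff' measurableSet_Ioi).2 (ae_of_all _ fun x hx => hx))
  have hm2 : Integrable (fun p : ℝ × ℝ => m p.2)
      ((volume.restrict (Ioc a b)).prod (volume.restrict (Ioi 0))) := by
    simpa using Integrable.mul_prod (integrable_const (1 : ℝ)) hm.restrict
  have hmeas : AEStronglyMeasurable (fun p : ℝ × ℝ => l p.1 p.2)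
      ((volume.restrict (Ioc a b)).prod (volume.restrict (Ioi 0))) := by
    refine (Complex.measurable_re.comp
      (measurable_stableDensity η γ)).aestronglyMeasurable.congr ?_
    filter_upwards [hfst, hsnd] with p h1 h2
    rw [Function.comp, ← hl.eq_stableDensity hL hη (hl.abs_lt_one hL hη hγ) (ha.trans h1).ne' h2,
      Complex.ofReal_re]
  refine (hm2.norm.const_mul (C / a)).mono' (hmeas.mul hm2.aestronglyMeasurable) ?_
  filter_upwards [hfst, hsnd] with p h1 h2
  rw [norm_mul]
  refine mul_le_mul_of_nonneg_right ((hC _ _ (ha.trans h1) h2).trans ?_) (norm_nonneg _)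
  exact div_le_div_of_nonneg_left hC0 ha h1.le

/-- The subordination formula for densities. -/
lemma HasDensity.eq_integral_mul {β ν : ℝ} {K K' : ℝ → SignedMeasure ℝ} {k k' : ℝ → ℝ → ℝ}
    (hK' : IsFundamentalSolution ν (-ν) β K') (hν0 : 0 < ν) (hν1 : ν ≤ 1) (hη : 0 < η)
    (hγ : |γ| ≤ 1) (hK : IsFundamentalSolution (η * ν) (γ * ν) β K)
    (hL : IsFundamentalSolution η γ 1 L) (hk : HasDensity K k) (hl : HasDensity L l)
    (hk' : HasDensity K' k') {x t : ℝ} (hx : 0 < x) (ht : 0 < t) :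
    k x t = ∫ ξ in Ioi (0 : ℝ), l x ξ * k' ξ t := by
  have hm := hk'.integrable t ht
  have hcont := hl.continuousOn_integral_mul hL hη hγ hm
  have hkc : ContinuousOn (fun x => k x t) (Ioi 0) :=
    (hk.continuousOn t ht).mono fun x hx => ne_of_gt hx
  -- Both sides are continuous on x > 0, so it suffices to compare integrals over intervals with a >
  -- 0; there Fubini reduces the claim to the formula for the set (a,b].
  refine sub_eq_zero.1 (eqOn_zero_of_forall_intervalIntegral_eq_zero (hkc.sub hcont)
    (fun a b ha hab => ?_) hx)
  have hsub : Icc a b ⊆ Ioi 0 := fun y hy => ha.trans_le hy.1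
  simp only [Pi.sub_apply]
  rw [intervalIntegral.integral_sub
    (hkc.mono (by rwa [uIcc_of_le hab])).intervalIntegrable
    (hcont.mono (by rwa [uIcc_of_le hab])).intervalIntegrable,
    intervalIntegral.integral_of_le hab, intervalIntegral.integral_of_le hab, sub_eq_zero,
    ← (hk.isWeighted ht).apply_eq _ measurableSet_Ioc,
    hK'.apply_eq_setIntegral hν0 hν1 hη hγ hK hL ht (hk'.isWeighted ht) measurableSet_Ioc,
    integral_integral_swap (hl.integrable_mul_prod hL hη hγ hm ha)]
  refine setIntegral_congr_fun measurableSet_Ioi fun ξ hξ => ?_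
  simp only [(hl.isWeighted hξ).apply_eq _ measurableSet_Ioc]
  rw [integral_mul_const, mul_comm]

end Densities

end FracDiff

theorem theorem1
    (α θ β η γ ν : ℝ)
    (hα0 : 0 < α) (hα2 : α ≤ 2) (hθ : |θ| ≤ min α (2 - α))
    (hβ0 : 0 < β) (hβ1 : β ≤ 1)
    (hη0 : 0 < η) (hη2 : η ≤ 2) (hγ : |γ| ≤ min η (2 - η))
    (hν0 : 0 < ν) (hν1 : ν ≤ 1)
    (hαν : α = η * ν) (hθν : θ = γ * ν)
    (K L K' : ℝ → SignedMeasure ℝ)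
    (hK : FracDiff.IsFundamentalSolution α θ β K)
    (hL : FracDiff.IsFundamentalSolution η γ 1 L)
    (hK' : FracDiff.IsFundamentalSolution ν (-ν) β K') :
    (∀ t : ℝ, 0 < t → ∀ B : Set ℝ, MeasurableSet B →
      (K' t).IntegrableOn (fun ξ => L ξ B) (Ioi 0) ∧
      K t B = ((K' t).restrict (Ioi 0)).integral (fun ξ => L ξ B)
        (ContinuousLinearMap.lsmul ℝ ℝ)) ∧
    (∀ k l k' : ℝ → ℝ → ℝ,
      FracDiff.HasDensity K k → FracDiff.HasDensity L l → FracDiff.HasDensity K' k' →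
      ∀ x t : ℝ, 0 < x → 0 < t →
        IntegrableOn (fun ξ => l x ξ * k' ξ t) (Ioi 0) ∧
        k x t = ∫ ξ in Ioi (0 : ℝ), l x ξ * k' ξ t) := by
  have hγ1 := FracDiff.abs_le_one_of_le_min hγ
  subst hαν hθν
  refine ⟨fun t ht B hB => FracDiff.integrableOn_and_apply_eq_integral hK' hν0 hν1 hη0 hγ1 hK hL
    ht hB, fun k l k' hk hl hk' x t hx ht => ⟨?_, ?_⟩⟩
  · exact hl.integrableOn_mul hL hη0 hγ1 (hk'.integrable t ht) hx
  · exact FracDiff.HasDensity.eq_integral_mul hK' hν0 hν1 hη0 hγ1 hK hL hk hl hk' hx ht
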